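/- **Setting.** Let $d\ge 1$ and let $(\xi_v)_{v\in\mathbb Z^d}$ be a (strictly) stationary real random field. For $A\subseteq\mathbb Z^d$ put $M_\xi(A)=\max_{v\in A}\xi_v$, with $M_\xi(\emptyset)=-\infty$. For $\mathbf r\in\mathbb R^d$ and $S\subseteq\mathbb R^d$, $\mathbf rS$ denotes coordinatewise scaling; $B(1)$ is the closed Euclidean unit ball; $|\cdot|$ is Lebesgue measure for subsets of $\mathbb R^d$ and cardinality for subsets of $\mathbb Z^d$. *Index sets.* Fix $p$. Let $D_n=C_n\cap\mathbb Z^d$, where each $C_n\subseteq\mathbb R^d$ is a union of $p$ convex bodies (compact convex sets with non-empty interior) and $|C_n|\to\infty$. Let $\mathbf c_n=(c_{n,1},\dots,c_{n,d})\in(0,\infty)^d$ be scaling vectors with $c_{n,\ell}\to\infty$ for every $\ell$, $c_{n,1}\cdots c_{n,d}\sim|C_n|$, and $C_n\subseteq\mathbf c_n[-c,c]^d$ for all $n$ and some $0<c<\infty$. For an integer $k\ge1$ let $t^\ell_{n,k}=\lfloor c_{n,\ell}/k^{1/d}\rfloor$, let $\mathbf t_{n,k}=(t_{n,k}^1,\dots,t_{n,k}^d)$,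 and let $D^+_{n,k}$ be the set of lattice points of all boxes $\mathbf t_{n,k}(z+[0,1)^d)$, $z\in\mathbb Z^d$, that intersect $C_n$. Let $K_n=\mathbb Z^d\cap\mathbf c_n[-\kappa,\kappa]^d$, where $0<\kappa<\infty$ is such that $D^+_{n,k}\subseteq K_n$ for all $n$ and all $k\ge1$. *Mixing.* For a real sequence $(x_n)$, the condition $\mathcal D(x_n;K_n)$ holds with mixing constants $(\alpha_n)$, $(\boldsymbol\gamma_n)$ if $\alpha_n\to0$, the vectors $\boldsymbol\gamma_n\in(0,\infty)^d$ are coordinatewise non-decreasing in $n$, $\gamma_{n,\ell}/c_{n,\ell}\to0$ for every $\ell$, and $$\bigl|P(M_\xi(A\cup B)\le x_n)-P(M_\xi(A)\le x_n)\,P(M_\xi(B)\le x_n)\bigr|\le\alpha_n$$ for all $n$ and all $A,B\subseteq K_n$ with $B\cap(A\oplus\boldsymbol\gamma_nB(1))=\emptyset$ (where $\oplus$ is the Minkowski sum) at least one of which is a box. *Local condition.* Let $\preceq$ be any translation invariant total order on $\mathbb Z^d$ and $A_0^{n,k}=\{z\in\mathbb Z^d: |z_\ell|\le t_{n,k}^\ell\text{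 for all }\ell,\ 0\prec z\}$. The condition $\mathcal D^\ell(x_n;k_n;\theta)$ means that $P\bigl(M_\xi(A_0^{n,k_n})\le x_n\mid \xi_0>x_n\bigr)\to\theta$ as $n\to\infty$. *Extremal index.* The field has extremal index $\theta\in[0,1]$ with respect to $(D_n)$ if for each $\tau>0$ there is a real sequence $(y_n)$ with $|D_n|P(\xi_0>y_n)\to\tau$ and $P(M_\xi(D_n)\le y_n)\to e^{-\theta\tau}$. **Theorem 3.8.** Suppose that for every $\tau\in(0,\infty)$ a real sequence $x_n(\tau)$ is given with $|D_n|P(\xi_0>x_n(\tau))\to\tau$, and that $\mathcal D(x_n(\tau);K_n)$ holds with mixing constants $\alpha_n(\tau)$ and $\boldsymbol\gamma_n(\tau)$. Let $\theta\in[0,1]$. Then the field has extremal index $\theta$ with respect to $(D_n)$ if and only if for every $\tau>0$ there is a sequence of positive integers $k_n=k_n(\tau)$ with $k_n\to\infty$, $k_n\alpha_n(\tau)\to0$ and $k_n^{1/d}\gamma_{n,\ell}(\tau)/c_{n,\ell}\to0$ for every $\ell=1,\dots,d$, such that $\mathcal D^\ell(x_n(\tau);k_n(\tau);\theta)$ holds.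 -/

import Mathlib

open MeasureTheory Filter Topology
open scoped Pointwise

namespace SpatialExtremes

/-! ### Geometry of the index sets -/

/-- The inclusion of the lattice `ℤ^d` into `ℝ^d`. -/
def toReal {d : ℕ} (v : Fin d → ℤ) : Fin d → ℝ := fun l => (v l : ℝ)

/-- The lattice points `S ∩ ℤ^d` of a set `S ⊆ ℝ^d`. -/
def latticePoints {d : ℕ} (S : Set (Fin d → ℝ)) : Set (Fin d → ℤ) := toReal ⁻¹' S

/-- A convex body: a compact convex set with non-empty interior. -/
def IsConvexBody {d : ℕ} (S : Set (Fin d → ℝ)) : Prop :=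
  IsCompact S ∧ Convex ℝ S ∧ (interior S).Nonempty

/-- A `p`-convex set: a union of `p` convex bodies. -/
def IsPConvex {d : ℕ} (p : ℕ) (S : Set (Fin d → ℝ)) : Prop :=
  ∃ body : Fin p → Set (Fin d → ℝ), (∀ i, IsConvexBody (body i)) ∧ S = ⋃ i, body i

/-- The closed box `c [-a, a]^d = ∏ l, [-a * c l, a * c l]`. -/
def scaledBox {d : ℕ} (c : Fin d → ℝ) (a : ℝ) : Set (Fin d → ℝ) :=
  {y | ∀ l, |y l| ≤ a * c l}

/-- The geometric assumption on the index sets `D n = C n ∩ ℤ^d`, where the sets `C n` are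
`p`-convex with the same `p` for all `n`, and `c n` are the scaling vectors. -/
structure IndexSetAssumption {d : ℕ} (p : ℕ) (D : ℕ → Set (Fin d → ℤ))
    (C : ℕ → Set (Fin d → ℝ)) (c : ℕ → Fin d → ℝ) : Prop where
  pconvex : ∀ n, IsPConvex p (C n)
  index_eq : ∀ n, D n = latticePoints (C n)
  volume_tendsto : Tendsto (fun n => volume.real (C n)) atTop atTop
  scaling_pos : ∀ n l, 0 < c n l
  scaling_tendsto : ∀ l, Tendsto (fun n => c n l) atTop atTop
  scaling_equiv :
    Asymptotics.IsEquivalent atTop (fun n => ∏ l, c n l) (fun n => volume.real (C n))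
  subset_box : ∃ a : ℝ, 0 < a ∧ ∀ n, C n ⊆ scaledBox (c n) a

/-- The integers `t^l = ⌊c_l / k^{1/d}⌋`. -/
noncomputable def sideLength {d : ℕ} (c : Fin d → ℝ) (k : ℕ) (l : Fin d) : ℤ :=
  ⌊c l / (k : ℝ) ^ (1 / (d : ℝ))⌋

/-- The half-open box `I_z = t (z + [0,1)^d) = ∏ l, [z_l t^l, (z_l + 1) t^l)`. -/
def cell {d : ℕ} (c : Fin d → ℝ) (k : ℕ) (z : Fin d → ℤ) : Set (Fin d → ℝ) :=
  {y | ∀ l, (z l : ℝ) * (sideLength c k l : ℝ) ≤ y l ∧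
    y l < ((z l : ℝ) + 1) * (sideLength c k l : ℝ)}

/-- The union `D⁺` of the lattice points of all boxes `I_z` that are intersected by `S`. -/
def outerApprox {d : ℕ} (S : Set (Fin d → ℝ)) (c : Fin d → ℝ) (k : ℕ) : Set (Fin d → ℤ) :=
  ⋃ z ∈ {z : Fin d → ℤ | (cell c k z ∩ S).Nonempty}, latticePoints (cell c k z)

/-- The constant `κ` defines a valid sequence of surrounding boxes
`K n = ℤ^d ∩ (c n) [-κ, κ]^d`: whatever the block number `k ≥ 1`, the outer approximation of
the `n`th index set by blocks is contained in `K n`. -/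
def IsSurrounding {d : ℕ} (C : ℕ → Set (Fin d → ℝ)) (c : ℕ → Fin d → ℝ) (κ : ℝ) : Prop :=
  0 < κ ∧ ∀ n k : ℕ, 1 ≤ k → outerApprox (C n) (c n) k ⊆ latticePoints (scaledBox (c n) κ)

/-! ### Random fields -/

/-- Strict stationarity: the law of the field is invariant under all translations. -/
def IsStationary {d : ℕ} {Ω : Type*} [MeasurableSpace Ω] (μ : Measure Ω)
    (ξ : (Fin d → ℤ) → Ω → ℝ) : Prop :=
  ∀ h : Fin d → ℤ, μ.map (fun ω v => ξ (v + h) ω) = μ.map (fun ω v => ξ v ω)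

/-- `M_ξ(A) = max_{v ∈ A} ξ_v`, with value `-∞` for the empty set. -/
noncomputable def fieldMax {d : ℕ} {Ω : Type*} (ξ : (Fin d → ℤ) → Ω → ℝ)
    (A : Set (Fin d → ℤ)) (ω : Ω) : EReal :=
  ⨆ v ∈ A, (ξ v ω : EReal)

/-- The probability `P(M_ξ(A) ≤ x)`. -/
noncomputable def probMaxLE {d : ℕ} {Ω : Type*} [MeasurableSpace Ω] (μ : Measure Ω)
    (ξ : (Fin d → ℤ) → Ω → ℝ) (A : Set (Fin d → ℤ)) (x : ℝ) : ℝ :=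
  μ.real {ω | fieldMax ξ A ω ≤ (x : EReal)}

/-- The coordinatewise scaled closed Euclidean unit ball `γ B(1)`. -/
def scaledBall {d : ℕ} (γ : Fin d → ℝ) : Set (Fin d → ℝ) :=
  {y | ∃ u : Fin d → ℝ, ∑ l, u l ^ 2 ≤ 1 ∧ ∀ l, y l = γ l * u l}

/-- `A` and `B` are `γ`-separated: `B ⊆ (A ⊕ γ B(1))ᶜ`. -/
def IsSeparated {d : ℕ} (γ : Fin d → ℝ) (A B : Set (Fin d → ℤ)) : Prop :=
  toReal '' B ⊆ (toReal '' A + scaledBall γ)ᶜ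

/-- A (bounded) box in `ℤ^d`. -/
def IsBox {d : ℕ} (A : Set (Fin d → ℤ)) : Prop :=
  ∃ a b : Fin d → ℤ, A = Set.Icc a b

/-- The mixing condition `𝒟(x_n; K_n)`, holding with mixing constants `α n` and `γ n`. -/
structure MixingCondition {d : ℕ} {Ω : Type*} [MeasurableSpace Ω] (μ : Measure Ω)
    (ξ : (Fin d → ℤ) → Ω → ℝ) (c : ℕ → Fin d → ℝ) (K : ℕ → Set (Fin d → ℤ))
    (x : ℕ → ℝ) (α : ℕ → ℝ) (γ : ℕ → Fin d → ℝ) : Prop where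
  sep_pos : ∀ n l, 0 < γ n l
  sep_mono : Monotone γ
  sep_littleO : ∀ l, Tendsto (fun n => γ n l / c n l) atTop (𝓝 0)
  rate_tendsto : Tendsto α atTop (𝓝 0)
  mixing : ∀ n, ∀ A B : Set (Fin d → ℤ), A ⊆ K n → B ⊆ K n → IsSeparated (γ n) A B →
    IsBox A ∨ IsBox B →
    |probMaxLE μ ξ (A ∪ B) (x n) - probMaxLE μ ξ A (x n) * probMaxLE μ ξ B (x n)| ≤ α n

/-- The growth conditions on the sequence of block numbers `k n ∈ {1, 2, …}`:
`k_n → ∞`, `k_n α_n → 0` and `k_n^{1/d} γ_n = o(c_n)`. -/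
structure IsAdmissible {d : ℕ} (c : ℕ → Fin d → ℝ) (α : ℕ → ℝ) (γ : ℕ → Fin d → ℝ)
    (k : ℕ → ℕ) : Prop where
  one_le : ∀ n, 1 ≤ k n
  tendsto_atTop : Tendsto k atTop atTop
  rate : Tendsto (fun n => (k n : ℝ) * α n) atTop (𝓝 0)
  sep : ∀ l, Tendsto (fun n => (k n : ℝ) ^ (1 / (d : ℝ)) * γ n l / c n l) atTop (𝓝 0)

/-- The set `A_0 = {z ∈ t [-1,1]^d ∩ ℤ^d : 0 ≺ z}` for a total order `ord` on `ℤ^d`, where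
`t` is the vector of the integers `sideLength c k l`. -/
def laterBlock {d : ℕ} (ord : LinearOrder (Fin d → ℤ)) (c : Fin d → ℝ) (k : ℕ) :
    Set (Fin d → ℤ) :=
  {z | (∀ l, |z l| ≤ sideLength c k l) ∧ ord.lt 0 z}

/-- The local condition `𝒟^ℓ(x_n; k_n; θ)`:
`P(M_ξ(A_0) ≤ x_n ∣ ξ_0 > x_n) → θ`. -/
def LocalCondition {d : ℕ} {Ω : Type*} [MeasurableSpace Ω] (μ : Measure Ω)
    (ξ : (Fin d → ℤ) → Ω → ℝ) (ord : LinearOrder (Fin d → ℤ)) (c : ℕ → Fin d → ℝ)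
    (x : ℕ → ℝ) (k : ℕ → ℕ) (θ : ℝ) : Prop :=
  Tendsto (fun n =>
    (ProbabilityTheory.cond μ {ω | x n < ξ 0 ω}).real
      {ω | fieldMax ξ (laterBlock ord (c n) (k n)) ω ≤ (x n : EReal)}) atTop (𝓝 θ)

/-- `|D_n| P(ξ_0 > x_n) → τ`. -/
def TailTendsto {d : ℕ} {Ω : Type*} [MeasurableSpace Ω] (μ : Measure Ω)
    (ξ : (Fin d → ℤ) → Ω → ℝ) (D : ℕ → Set (Fin d → ℤ)) (x : ℕ → ℝ) (τ : ℝ) : Prop :=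
  Tendsto (fun n => ((D n).ncard : ℝ) * μ.real {ω | x n < ξ 0 ω}) atTop (𝓝 τ)

/-- The field has extremal index `θ` with respect to `(D n)`. -/
def HasExtremalIndex {d : ℕ} {Ω : Type*} [MeasurableSpace Ω] (μ : Measure Ω)
    (ξ : (Fin d → ℤ) → Ω → ℝ) (D : ℕ → Set (Fin d → ℤ)) (θ : ℝ) : Prop :=
  ∀ τ : ℝ, 0 < τ → ∃ x : ℕ → ℝ, TailTendsto μ ξ D x τ ∧
    Tendsto (fun n => probMaxLE μ ξ (D n) (x n)) atTop (𝓝 (Real.exp (-θ * τ)))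

end SpatialExtremes

namespace SpatialExtremes

/-! ### Counting the grid cells at the boundary of a convex set -/

/-! Everything rests on one comparison, `tendsto_probMaxLE_sub_exp`: for any admissible `k`, the
difference between P(M(D_n) ≤ x_n) and exp(-τ r_n) tends to 0, where r_n is the conditional
probability of the local condition. No convergence of r_n is assumed, so since τ > 0 the maxima
converge to exp(-θτ) exactly when r_n → θ. Admissible block numbers always exist
(`exists_isAdmissible`), and level sequences with the same tail limit give the same limit for the
maxima (`probMaxLE_level_sub_le`), so the levels in the definition of the extremal index may be
exchanged for the given ones.

For the comparison, let P = P(ξ_0 > x_n) and let N be the number of lattice points of a block, so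
that k_n N P → τ. Cover D_n by the m_n grid cells that meet C_n. Boundary cells of a union of p
convex bodies are negligible (`IndexSetAssumption.tendsto_card_boundaryCells`), hence m_n/k_n → 1
and the cover adds only o(|D_n|) points. Shrinking every block by ⌈γ_n⌉ separates the blocks; mixing
applied one block at a time makes the probability of no exceedance nearly (1-q)^m, with q the
exceedance probability of one block, and this is close to exp(-k q).

It remains to see that q is close to N P r. The events that j in the block is an exceedance followed
by no other within j + t[-1,1]^d are disjoint, each of probability P r, and they exhaust the
exceedance event of the block unless the surrounding blocks contain an exceedance too. By mixing,
this exceptional event has probability O((NP)² + α_n) plus a border term, which is o(1/k_n).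
`MixingAt.abs_probMaxLE_sub_exp_le` collects all the errors at a fixed n. -/

/-- The half-open box `t (z + [0,1)^d)` for a real vector `t` of side lengths. -/
def gridCell {d : ℕ} (t : Fin d → ℝ) (z : Fin d → ℤ) : Set (Fin d → ℝ) :=
  {y | ∀ l, (z l : ℝ) * t l ≤ y l ∧ y l < ((z l : ℝ) + 1) * t l}

/-- The indices of the grid cells that intersect `S`. -/
def meetingCells {d : ℕ} (t : Fin d → ℝ) (S : Set (Fin d → ℝ)) : Set (Fin d → ℤ) :=
  {z | (gridCell t z ∩ S).Nonempty}

/-- The indices of the grid cells that are contained in `S`. -/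
def innerCells {d : ℕ} (t : Fin d → ℝ) (S : Set (Fin d → ℝ)) : Set (Fin d → ℤ) :=
  {z | gridCell t z ⊆ S}

/-- The indices of the grid cells that intersect `S` but are not contained in it. -/
def boundaryCells {d : ℕ} (t : Fin d → ℝ) (S : Set (Fin d → ℝ)) : Set (Fin d → ℤ) :=
  meetingCells t S \ innerCells t S

/-- The vector of signs encoded by a Boolean vector. -/
def signVec {d : ℕ} (s : Fin d → Bool) : Fin d → ℤ := fun l => if s l then 1 else -1

/-- The cells intersecting `S` that are the last ones to do so in the diagonal direction `s`. -/
def extremeCells {d : ℕ} (t : Fin d → ℝ) (S : Set (Fin d → ℝ)) (s : Fin d → Bool) :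
    Set (Fin d → ℤ) :=
  {z ∈ meetingCells t S | ∀ j : ℕ, 1 ≤ j → z + (j : ℤ) • signVec s ∉ meetingCells t S}

/-- A point of the cell outside `S` is separated from `S` by a hyperplane; moving the cell
diagonally along the signs of the normal vector only goes further away from `S`. -/
theorem boundaryCells_subset_extremeCells {d : ℕ} {t : Fin d → ℝ} (ht : ∀ l, 0 < t l)
    {S : Set (Fin d → ℝ)} (hS : Convex ℝ S) (hc : IsClosed S) :
    boundaryCells t S ⊆ ⋃ s, extremeCells t S s := by
  rintro z ⟨hz, hz'⟩
  obtain ⟨y, hyz, hyS⟩ := Set.not_subset.1 hz'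
  obtain ⟨f, u, hf, hu⟩ := geometric_hahn_banach_closed_point hS hc hyS
  refine Set.mem_iUnion.2 ⟨fun l => decide (0 ≤ f (Pi.single l 1)), hz, ?_⟩
  rintro j hj ⟨w, hw, hwS⟩
  have hj' : (1 : ℝ) ≤ j := by exact_mod_cast hj
  have hdecomp : ∀ v : Fin d → ℝ, f v = ∑ l, v l * f (Pi.single l 1) := by
    intro v
    conv_lhs => rw [pi_eq_sum_univ' v]
    simp [map_sum, Pi.single]
  -- A shift by at least one cell moves each coordinate of `w` past that of `y`, in the direction in
  -- which `f` does not decrease.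
  have h1 : f y ≤ f w := by
    rw [hdecomp y, hdecomp w]
    refine Finset.sum_le_sum fun l _ => ?_
    have hw1 := hw l
    have hy1 := hyz l
    have htl := ht l
    by_cases h : 0 ≤ f (Pi.single l 1)
    · refine mul_le_mul_of_nonneg_right ?_ h
      simp only [signVec, Pi.add_apply, Pi.smul_apply, h, decide_true, if_true, smul_eq_mul,
        mul_one] at hw1
      push_cast at hw1
      nlinarith [hw1.1, hy1.2]
    · refine mul_le_mul_of_nonpos_right ?_ (not_le.1 h).le
      simp only [signVec, Pi.add_apply, Pi.smul_apply, h, decide_false, smul_eq_mul] at hw1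
      push_cast at hw1
      simp at hw1
      nlinarith [hw1.2, hy1.1]
  linarith [hf w hwS]

/-- The translates of `F` by `j • signVec s` with `j < J` are pairwise disjoint and lie in the box
of half-widths `R l + J`. The factor 5 comes from 2(R + J) + 1 ≤ 5R, valid since 1 ≤ J ≤ R. -/
theorem card_le_of_diagonal_free {d : ℕ} (F : Finset (Fin d → ℤ)) (s : Fin d → Bool)
    (hF : ∀ z ∈ F, ∀ j : ℕ, 1 ≤ j → z + (j : ℤ) • signVec s ∉ F) (R : Fin d → ℝ)
    (hR : ∀ z ∈ F, ∀ l, |(z l : ℝ)| ≤ R l) (J : ℕ) (hJ : 1 ≤ J) (hJR : ∀ l, (J : ℝ) ≤ R l) :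
    (J : ℝ) * F.card ≤ ∏ l, (5 * R l) := by
  classical
  set T : Finset (Fin d → ℤ) := Fintype.piFinset fun l => Finset.Icc (-⌊R l + J⌋) ⌊R l + J⌋
  have hJ' : (1 : ℝ) ≤ J := by exact_mod_cast hJ
  have hcard : (Finset.range J ×ˢ F).card ≤ T.card := by
    refine Finset.card_le_card_of_injOn (fun q => q.2 + (q.1 : ℤ) • signVec s) ?_ ?_
    · rintro ⟨j, z⟩ hq
      simp only [Finset.coe_product, Set.mem_prod, Finset.mem_coe, Finset.mem_range] at hq
      simp only [T, Finset.mem_coe, Fintype.mem_piFinset, Finset.mem_Icc]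
      intro l
      have h1 := abs_le.1 (hR z hq.2 l)
      have h2 : (j : ℝ) ≤ J := by exact_mod_cast hq.1.le
      rw [neg_le, Int.le_floor, Int.le_floor]
      simp only [signVec, Pi.add_apply, Pi.smul_apply, smul_eq_mul]
      have h3 : (0 : ℝ) ≤ j := Nat.cast_nonneg j
      split_ifs <;> push_cast <;> constructor <;> linarith
    · have key : ∀ (j : ℕ) z (j' : ℕ) z', z ∈ F → z' ∈ F → j ≤ j' →
          z + (j : ℤ) • signVec s = z' + (j' : ℤ) • signVec s → j = j' ∧ z = z' := by
        intro j z j' z' hz hz' hjj h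
        have h1 : z = z' + ((j' - j : ℕ) : ℤ) • signVec s := by
          rw [Nat.cast_sub hjj, sub_smul, ← add_sub_assoc, ← h, add_sub_cancel_right]
        rcases hjj.eq_or_lt with h2 | h2
        · subst h2
          exact ⟨rfl, by simpa using h1⟩
        · exact absurd (h1 ▸ hz) (hF z' hz' _ (by omega))
      rintro ⟨j, z⟩ hq ⟨j', z'⟩ hq' h
      simp only [Finset.coe_product, Set.mem_prod, Finset.mem_coe, Finset.mem_range] at hq hq'
      rcases le_total j j' with hjj | hjj
      · obtain ⟨h1, h2⟩ := key j z j' z' hq.2 hq'.2 hjj h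
        rw [h1, h2]
      · obtain ⟨h1, h2⟩ := key j' z' j z hq'.2 hq.2 hjj h.symm
        rw [h1, h2]
  rw [Finset.card_product, Finset.card_range] at hcard
  calc (J : ℝ) * F.card ≤ T.card := by exact_mod_cast hcard
    _ = ∏ l, ((Finset.Icc (-⌊R l + J⌋) ⌊R l + J⌋).card : ℝ) := by
        simp [T, Fintype.card_piFinset]
    _ ≤ ∏ l, (5 * R l) := by
        refine Finset.prod_le_prod (fun _ _ => Nat.cast_nonneg _) fun l _ => ?_
        have h0 : 0 ≤ ⌊R l + J⌋ := Int.floor_nonneg.2 (by linarith [hJR l])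
        have h1 : (((Finset.Icc (-⌊R l + J⌋) ⌊R l + J⌋).card : ℤ) : ℝ)
            = 2 * (⌊R l + J⌋ : ℝ) + 1 := by
          rw [Int.card_Icc, Int.toNat_of_nonneg (by omega)]
          push_cast
          ring
        rw [Int.cast_natCast] at h1
        rw [h1]
        linarith [Int.floor_le (R l + J), hJR l]

theorem abs_index_le_of_mem_meetingCells {d : ℕ} {t : Fin d → ℝ} (ht : ∀ l, 0 < t l)
    {S : Set (Fin d → ℝ)} {r : Fin d → ℝ} (hr : ∀ y ∈ S, ∀ l, |y l| ≤ r l) {z : Fin d → ℤ}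
    (hz : z ∈ meetingCells t S) (l : Fin d) : |(z l : ℝ)| ≤ r l / t l + 1 := by
  obtain ⟨y, hy, hyS⟩ := hz
  have h1 := abs_le.1 (hr y hyS l)
  have h2 := hy l
  have h3 := ht l
  have h4 : r l / t l * t l = r l := div_mul_cancel₀ _ h3.ne'
  rw [abs_le]
  constructor <;> by_contra! h <;> nlinarith

theorem finite_meetingCells {d : ℕ} {t : Fin d → ℝ} (ht : ∀ l, 0 < t l)
    {S : Set (Fin d → ℝ)} {r : Fin d → ℝ} (hr : ∀ y ∈ S, ∀ l, |y l| ≤ r l) :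
    (meetingCells t S).Finite := by
  refine (Set.finite_Icc (fun l => -⌊r l / t l + 1⌋) (fun l => ⌊r l / t l + 1⌋)).subset ?_
  intro z hz
  refine ⟨fun l => ?_, fun l => ?_⟩
  · have := abs_le.1 (abs_index_le_of_mem_meetingCells ht hr hz l)
    rw [neg_le, Int.le_floor]
    push_cast
    linarith
  · have := abs_le.1 (abs_index_le_of_mem_meetingCells ht hr hz l)
    rw [Int.le_floor]
    linarith

/-- The diagonal count is summed over the `2 ^ d` sign vectors. The free parameter `J` is what later
makes boundary cells negligible. -/
theorem card_boundaryCells_le {d : ℕ} {t : Fin d → ℝ} (ht : ∀ l, 0 < t l)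
    {S : Set (Fin d → ℝ)} (hS : Convex ℝ S) (hc : IsClosed S) {r : Fin d → ℝ}
    (hr : ∀ y ∈ S, ∀ l, |y l| ≤ r l) (J : ℕ) (hJ : 1 ≤ J)
    (hJR : ∀ l, (J : ℝ) ≤ r l / t l + 1) :
    (J : ℝ) * (boundaryCells t S).ncard ≤ 2 ^ d * ∏ l, (5 * (r l / t l + 1)) := by
  have hfin := finite_meetingCells ht hr
  have hfin' : ∀ s, (extremeCells t S s).Finite := fun s => hfin.subset fun z hz => hz.1
  have h1 : ∀ s, (J : ℝ) * (extremeCells t S s).ncard ≤ ∏ l, (5 * (r l / t l + 1)) := by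
    intro s
    rw [Set.ncard_eq_toFinset_card _ (hfin' s)]
    refine card_le_of_diagonal_free _ s ?_ _ ?_ J hJ hJR
    · intro z hz j hj h
      rw [Set.Finite.mem_toFinset] at hz h
      exact hz.2 j hj h.1
    · intro z hz l
      rw [Set.Finite.mem_toFinset] at hz
      exact abs_index_le_of_mem_meetingCells ht hr hz.1 l
  have h2 : (boundaryCells t S).ncard ≤ ∑ s, (extremeCells t S s).ncard := by
    refine (Set.ncard_le_ncard (boundaryCells_subset_extremeCells ht hS hc)
      (Set.finite_iUnion hfin')).trans ?_
    exact Set.ncard_iUnion_le_of_fintype _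
  calc (J : ℝ) * (boundaryCells t S).ncard
      ≤ J * ∑ s : Fin d → Bool, ((extremeCells t S s).ncard : ℝ) := by
        gcongr
        exact_mod_cast h2
    _ = ∑ s : Fin d → Bool, (J : ℝ) * (extremeCells t S s).ncard := Finset.mul_sum _ _ _
    _ ≤ ∑ s : Fin d → Bool, ∏ l, (5 * (r l / t l + 1)) := Finset.sum_le_sum fun s _ => h1 s
    _ = 2 ^ d * ∏ l, (5 * (r l / t l + 1)) := by simp

theorem card_boundaryCells_le_of_isPConvex {d p : ℕ} {t : Fin d → ℝ} (ht : ∀ l, 0 < t l)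
    {S : Set (Fin d → ℝ)} (hS : IsPConvex p S) {r : Fin d → ℝ}
    (hr : ∀ y ∈ S, ∀ l, |y l| ≤ r l) (J : ℕ) (hJ : 1 ≤ J)
    (hJR : ∀ l, (J : ℝ) ≤ r l / t l + 1) :
    (J : ℝ) * (boundaryCells t S).ncard ≤ p * (2 ^ d * ∏ l, (5 * (r l / t l + 1))) := by
  obtain ⟨body, hbody, rfl⟩ := hS
  have hr' : ∀ i, ∀ y ∈ body i, ∀ l, |y l| ≤ r l := fun i y hy =>
    hr y (Set.mem_iUnion_of_mem i hy)
  -- A cell that is not contained in the union is contained in none of the bodies, in particular not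
  -- in one that it meets.
  have hsub : boundaryCells t (⋃ i, body i) ⊆ ⋃ i, boundaryCells t (body i) := by
    rintro z ⟨⟨y, hy, hyS⟩, hz⟩
    obtain ⟨i, hi⟩ := Set.mem_iUnion.1 hyS
    exact Set.mem_iUnion.2 ⟨i, ⟨y, hy, hi⟩, fun h => hz (h.trans (Set.subset_iUnion body i))⟩
  have h2 : (boundaryCells t (⋃ i, body i)).ncard ≤ ∑ i, (boundaryCells t (body i)).ncard :=
    (Set.ncard_le_ncard hsub (Set.finite_iUnion fun i =>
      (finite_meetingCells ht (hr' i)).subset Set.sdiff_subset)).trans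
      (Set.ncard_iUnion_le_of_fintype _)
  calc (J : ℝ) * (boundaryCells t (⋃ i, body i)).ncard
      ≤ J * ∑ i, ((boundaryCells t (body i)).ncard : ℝ) := by
        gcongr
        exact_mod_cast h2
    _ = ∑ i, (J : ℝ) * (boundaryCells t (body i)).ncard := Finset.mul_sum _ _ _
    _ ≤ ∑ i : Fin p, (2 ^ d * ∏ l, (5 * (r l / t l + 1))) := Finset.sum_le_sum fun i _ =>
        card_boundaryCells_le ht (hbody i).2.1 (hbody i).1.isClosed (hr' i) J hJ hJR
    _ = p * (2 ^ d * ∏ l, (5 * (r l / t l + 1))) := by simp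

/-! ### Comparison of cell counts with volume. -/

theorem gridCell_eq_pi {d : ℕ} (t : Fin d → ℝ) (z : Fin d → ℤ) :
    gridCell t z = Set.univ.pi fun l => Set.Ico ((z l : ℝ) * t l) (((z l : ℝ) + 1) * t l) := by
  ext y
  simp [gridCell]

theorem measurableSet_gridCell {d : ℕ} (t : Fin d → ℝ) (z : Fin d → ℤ) :
    MeasurableSet (gridCell t z) := by
  rw [gridCell_eq_pi]
  exact MeasurableSet.univ_pi fun _ => measurableSet_Ico

theorem volume_real_gridCell {d : ℕ} {t : Fin d → ℝ} (ht : ∀ l, 0 < t l) (z : Fin d → ℤ) :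
    volume.real (gridCell t z) = ∏ l, t l := by
  rw [gridCell_eq_pi, Measure.real, Real.volume_pi_Ico_toReal]
  · exact Finset.prod_congr rfl fun l _ => by ring
  · intro l
    nlinarith [ht l]

theorem volume_gridCell_ne_top {d : ℕ} (t : Fin d → ℝ) (z : Fin d → ℤ) :
    volume (gridCell t z) ≠ ⊤ := by
  rw [gridCell_eq_pi, Real.volume_pi_Ico]
  exact ENNReal.prod_ne_top fun _ _ => ENNReal.ofReal_ne_top

/-- The index of the grid cell containing a point. -/
noncomputable def cellIndex {d : ℕ} (t : Fin d → ℝ) (y : Fin d → ℝ) : Fin d → ℤ :=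
  fun l => ⌊y l / t l⌋

theorem mem_gridCell_iff {d : ℕ} {t : Fin d → ℝ} (ht : ∀ l, 0 < t l) {z : Fin d → ℤ}
    {y : Fin d → ℝ} : y ∈ gridCell t z ↔ cellIndex t y = z := by
  rw [funext_iff]
  refine forall_congr' fun l => ?_
  rw [cellIndex, Int.floor_eq_iff, le_div_iff₀ (ht l), div_lt_iff₀ (ht l)]

theorem card_innerCells_mul_le_volume {d : ℕ} {t : Fin d → ℝ} (ht : ∀ l, 0 < t l)
    {S : Set (Fin d → ℝ)} (hS : volume S ≠ ⊤) (hfin : (innerCells t S).Finite) :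
    (innerCells t S).ncard * ∏ l, t l ≤ volume.real S := by
  have h1 : volume.real (⋃ z ∈ hfin.toFinset, gridCell t z)
      = ∑ z ∈ hfin.toFinset, volume.real (gridCell t z) := by
    refine measureReal_biUnion_finset ?_ (fun z _ => measurableSet_gridCell t z)
      (fun z _ => volume_gridCell_ne_top t z)
    intro z _ z' _ hzz
    rw [Function.onFun, Set.disjoint_left]
    intro y hy hy'
    exact hzz (((mem_gridCell_iff ht).1 hy).symm.trans ((mem_gridCell_iff ht).1 hy'))
  simp only [volume_real_gridCell ht, Finset.sum_const, nsmul_eq_mul] at h1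
  rw [Set.ncard_eq_toFinset_card _ hfin, ← h1]
  refine measureReal_mono (Set.iUnion₂_subset fun z hz => ?_) hS
  exact (Set.Finite.mem_toFinset hfin).1 hz

theorem volume_le_card_meetingCells_mul {d : ℕ} {t : Fin d → ℝ} (ht : ∀ l, 0 < t l)
    {S : Set (Fin d → ℝ)} (hfin : (meetingCells t S).Finite) :
    volume.real S ≤ (meetingCells t S).ncard * ∏ l, t l := by
  have h1 : volume.real (⋃ z ∈ hfin.toFinset, gridCell t z)
      ≤ ∑ z ∈ hfin.toFinset, volume.real (gridCell t z) := measureReal_biUnion_finset_le _ _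
  simp only [volume_real_gridCell ht, Finset.sum_const, nsmul_eq_mul] at h1
  rw [Set.ncard_eq_toFinset_card _ hfin]
  refine (measureReal_mono ?_ ?_).trans h1
  · intro y hy
    have := (mem_gridCell_iff ht (y := y)).2 rfl
    exact Set.mem_biUnion (hfin.mem_toFinset.2 ⟨y, this, hy⟩) this
  · exact ((measure_biUnion_lt_top hfin.toFinset.finite_toSet
      fun z _ => (volume_gridCell_ne_top t z).lt_top)).ne

theorem innerCells_subset_meetingCells {d : ℕ} {t : Fin d → ℝ} (ht : ∀ l, 0 < t l)
    (S : Set (Fin d → ℝ)) : innerCells t S ⊆ meetingCells t S := by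
  intro z hz
  have : (fun l => (z l : ℝ) * t l) ∈ gridCell t z := fun l => ⟨le_rfl, by nlinarith [ht l]⟩
  exact ⟨_, this, hz this⟩

theorem card_meetingCells_eq {d : ℕ} {t : Fin d → ℝ} (ht : ∀ l, 0 < t l)
    {S : Set (Fin d → ℝ)} (hfin : (meetingCells t S).Finite) :
    (meetingCells t S).ncard = (innerCells t S).ncard + (boundaryCells t S).ncard := by
  rw [boundaryCells, add_comm]
  exact (Set.ncard_sdiff_add_ncard_of_subset (innerCells_subset_meetingCells ht S) hfin).symm

end SpatialExtremes

namespace SpatialExtremes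

/-! ### Exceedance probabilities of stationary fields -/

section Field

variable {d : ℕ} {Ω : Type*} {ξ : (Fin d → ℤ) → Ω → ℝ}

/-- The event that the field exceeds the level `x` somewhere in `A`. -/
def exceedSet (ξ : (Fin d → ℤ) → Ω → ℝ) (A : Set (Fin d → ℤ)) (x : ℝ) : Set Ω :=
  {ω | ∃ v ∈ A, x < ξ v ω}

theorem fieldMax_le_iff {A : Set (Fin d → ℤ)} {ω : Ω} {x : ℝ} :
    fieldMax ξ A ω ≤ (x : EReal) ↔ ∀ v ∈ A, ξ v ω ≤ x := by
  simp [fieldMax, iSup_le_iff]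

theorem setOf_fieldMax_le_eq_compl (A : Set (Fin d → ℤ)) (x : ℝ) :
    {ω | fieldMax ξ A ω ≤ (x : EReal)} = (exceedSet ξ A x)ᶜ := by
  ext ω
  simp [fieldMax_le_iff, exceedSet]

theorem exceedSet_union (A B : Set (Fin d → ℤ)) (x : ℝ) :
    exceedSet ξ (A ∪ B) x = exceedSet ξ A x ∪ exceedSet ξ B x := by
  ext ω
  simp [exceedSet, or_and_right, exists_or]

variable [MeasurableSpace Ω] {μ : Measure Ω}

theorem measurableSet_exceedSet (hξ : ∀ v, Measurable (ξ v)) (A : Set (Fin d → ℤ)) (x : ℝ) :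
    MeasurableSet (exceedSet ξ A x) := by
  have : exceedSet ξ A x = ⋃ v ∈ A, {ω | x < ξ v ω} := by
    ext ω
    simp [exceedSet]
  rw [this]
  exact MeasurableSet.biUnion A.to_countable fun v _ => measurableSet_lt measurable_const (hξ v)

theorem probMaxLE_eq [IsProbabilityMeasure μ] (hξ : ∀ v, Measurable (ξ v))
    (A : Set (Fin d → ℤ)) (x : ℝ) :
    probMaxLE μ ξ A x = 1 - μ.real (exceedSet ξ A x) := by
  rw [probMaxLE, setOf_fieldMax_le_eq_compl, probReal_compl_eq_one_sub
    (measurableSet_exceedSet hξ A x)]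

theorem probMaxLE_empty [IsProbabilityMeasure μ] (x : ℝ) : probMaxLE μ ξ ∅ x = 1 := by
  simp [probMaxLE, fieldMax]

theorem probMaxLE_nonneg (A : Set (Fin d → ℤ)) (x : ℝ) : 0 ≤ probMaxLE μ ξ A x :=
  measureReal_nonneg

theorem probMaxLE_le_one [IsProbabilityMeasure μ] (A : Set (Fin d → ℤ)) (x : ℝ) :
    probMaxLE μ ξ A x ≤ 1 :=
  measureReal_le_one

/-- Events of the path space have the same probability for all translates of the field. -/
theorem IsStationary.measureReal_eq (hξ : ∀ v, Measurable (ξ v)) (hstat : IsStationary μ ξ)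
    (h : Fin d → ℤ) {E : Set ((Fin d → ℤ) → ℝ)} (hE : MeasurableSet E) :
    μ.real {ω | (fun v => ξ (v + h) ω) ∈ E} = μ.real {ω | (fun v => ξ v ω) ∈ E} := by
  have h1 : (μ.map fun ω v => ξ (v + h) ω).real E = (μ.map fun ω v => ξ v ω).real E := by
    rw [hstat h]
  rwa [map_measureReal_apply (measurable_pi_lambda _ fun v => hξ _) hE,
    map_measureReal_apply (measurable_pi_lambda _ fun v => hξ _) hE] at h1

theorem IsStationary.exceed_point (hξ : ∀ v, Measurable (ξ v)) (hstat : IsStationary μ ξ)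
    (v : Fin d → ℤ) (x : ℝ) : μ.real {ω | x < ξ v ω} = μ.real {ω | x < ξ 0 ω} := by
  have := hstat.measureReal_eq hξ v (E := {f | x < f 0})
    (measurableSet_lt measurable_const (measurable_pi_apply 0))
  simpa using this

theorem measurableSet_forall_le (A : Set (Fin d → ℤ)) (x : ℝ) :
    MeasurableSet {f : (Fin d → ℤ) → ℝ | ∀ v ∈ A, f v ≤ x} := by
  have : {f : (Fin d → ℤ) → ℝ | ∀ v ∈ A, f v ≤ x} = ⋂ v ∈ A, {f | f v ≤ x} := by
    ext f
    simp
  rw [this]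
  exact MeasurableSet.biInter A.to_countable fun v _ =>
    measurableSet_le (measurable_pi_apply v) measurable_const

theorem IsStationary.probMaxLE_translate (hξ : ∀ v, Measurable (ξ v))
    (hstat : IsStationary μ ξ) {A B : Set (Fin d → ℤ)} {h : Fin d → ℤ}
    (hAB : ∀ v, v ∈ B ↔ v - h ∈ A) (x : ℝ) : probMaxLE μ ξ B x = probMaxLE μ ξ A x := by
  have := hstat.measureReal_eq hξ h (measurableSet_forall_le A x)
  simp only [probMaxLE, fieldMax_le_iff]
  refine Eq.trans (congrArg _ ?_) this
  ext ω
  change (∀ v ∈ B, ξ v ω ≤ x) ↔ ∀ v ∈ A, ξ (v + h) ω ≤ x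
  simp only [hAB]
  constructor
  · intro H v hv
    exact H _ (by simpa using hv)
  · intro H v hv
    simpa using H _ hv

theorem IsStationary.exceed_last (hξ : ∀ v, Measurable (ξ v)) (hstat : IsStationary μ ξ)
    (A : Set (Fin d → ℤ)) (j : Fin d → ℤ) (x : ℝ) :
    μ.real {ω | x < ξ j ω ∧ ∀ v ∈ A, ξ (v + j) ω ≤ x}
      = μ.real {ω | x < ξ 0 ω ∧ ∀ v ∈ A, ξ v ω ≤ x} := by
  have := hstat.measureReal_eq hξ j (E := {f | x < f 0} ∩ {f | ∀ v ∈ A, f v ≤ x})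
    ((measurableSet_lt measurable_const (measurable_pi_apply 0)).inter
      (measurableSet_forall_le A x))
  simpa using this

theorem measureReal_exceedSet_le [IsFiniteMeasure μ] (hξ : ∀ v, Measurable (ξ v))
    (hstat : IsStationary μ ξ) {A : Set (Fin d → ℤ)} (hA : A.Finite) (x : ℝ) :
    μ.real (exceedSet ξ A x) ≤ A.ncard * μ.real {ω | x < ξ 0 ω} := by
  have : exceedSet ξ A x = ⋃ v ∈ hA.toFinset, {ω | x < ξ v ω} := by
    ext ω
    simp [exceedSet]
  rw [this, Set.ncard_eq_toFinset_card _ hA]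
  refine (measureReal_biUnion_finset_le _ _).trans_eq ?_
  simp [hstat.exceed_point hξ]

theorem probMaxLE_anti [IsFiniteMeasure μ] {A B : Set (Fin d → ℤ)} (h : A ⊆ B) (x : ℝ) :
    probMaxLE μ ξ B x ≤ probMaxLE μ ξ A x := by
  refine measureReal_mono fun ω hω => ?_
  simp only [Set.mem_ofPred_eq, fieldMax_le_iff] at hω ⊢
  exact fun v hv => hω v (h hv)

theorem probMaxLE_sub_le [IsProbabilityMeasure μ] (hξ : ∀ v, Measurable (ξ v))
    (hstat : IsStationary μ ξ) {A B : Set (Fin d → ℤ)} (h : A ⊆ B) (hB : B.Finite) (x : ℝ) :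
    |probMaxLE μ ξ A x - probMaxLE μ ξ B x|
      ≤ ((B.ncard : ℝ) - A.ncard) * μ.real {ω | x < ξ 0 ω} := by
  have h1 : (A ∪ B \ A) = B := Set.union_sdiff_cancel h
  have h2 := measureReal_exceedSet_le hξ hstat (hB.subset (Set.sdiff_subset (t := A))) x
  have h3 : ((B \ A).ncard : ℝ) = B.ncard - A.ncard := by
    rw [eq_sub_iff_add_eq]
    exact_mod_cast Set.ncard_sdiff_add_ncard_of_subset h hB
  rw [h3] at h2
  have h4 := measureReal_union_le (μ := μ) (exceedSet ξ A x) (exceedSet ξ (B \ A) x)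
  rw [← exceedSet_union, h1] at h4
  rw [abs_of_nonneg (sub_nonneg.2 (probMaxLE_anti h x)), probMaxLE_eq hξ, probMaxLE_eq hξ]
  linarith

/-- The two events differ only if some value in `A` lies in `(x, y]`; a union bound and stationarity
give the estimate. -/
theorem probMaxLE_level_sub_le_of_le [IsProbabilityMeasure μ] (hξ : ∀ v, Measurable (ξ v))
    (hstat : IsStationary μ ξ) {A : Set (Fin d → ℤ)} (hA : A.Finite) {x y : ℝ} (hxy : x ≤ y) :
    |probMaxLE μ ξ A y - probMaxLE μ ξ A x|
      ≤ A.ncard * |μ.real {ω | x < ξ 0 ω} - μ.real {ω | y < ξ 0 ω}| := by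
  have hsub : ∀ v, {ω | y < ξ v ω} ⊆ {ω | x < ξ v ω} := fun v ω hω => hxy.trans_lt hω
  have h0 : exceedSet ξ A y ⊆ exceedSet ξ A x := fun ω ⟨v, hv, h⟩ => ⟨v, hv, hxy.trans_lt h⟩
  have h1 : exceedSet ξ A x ⊆ exceedSet ξ A y ∪
      ⋃ v ∈ hA.toFinset, ({ω | x < ξ v ω} \ {ω | y < ξ v ω}) := by
    rintro ω ⟨v, hv, hx⟩
    by_cases hy : y < ξ v ω
    · exact Or.inl ⟨v, hv, hy⟩
    · exact Or.inr (Set.mem_biUnion (hA.mem_toFinset.2 hv) ⟨hx, hy⟩)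
  have h2 : ∀ v, μ.real ({ω | x < ξ v ω} \ {ω | y < ξ v ω})
      = μ.real {ω | x < ξ 0 ω} - μ.real {ω | y < ξ 0 ω} := by
    intro v
    rw [measureReal_sdiff (hsub v) (measurableSet_lt measurable_const (hξ v)),
      hstat.exceed_point hξ v x, hstat.exceed_point hξ v y]
  have h3 := (measureReal_mono (μ := μ) h1).trans (measureReal_union_le _ _)
  have h4 := measureReal_biUnion_finset_le (μ := μ) hA.toFinset
    fun v => {ω | x < ξ v ω} \ {ω | y < ξ v ω}
  simp only [h2, Finset.sum_const, nsmul_eq_mul] at h4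
  have h5 := measureReal_mono (μ := μ) (hsub 0)
  have h6 := measureReal_mono (μ := μ) h0
  rw [probMaxLE_eq hξ, probMaxLE_eq hξ, abs_of_nonneg (by linarith), abs_of_nonneg (by linarith),
    Set.ncard_eq_toFinset_card _ hA]
  linarith

theorem probMaxLE_level_sub_le [IsProbabilityMeasure μ] (hξ : ∀ v, Measurable (ξ v))
    (hstat : IsStationary μ ξ) {A : Set (Fin d → ℤ)} (hA : A.Finite) (x y : ℝ) :
    |probMaxLE μ ξ A y - probMaxLE μ ξ A x|
      ≤ |A.ncard * μ.real {ω | x < ξ 0 ω} - A.ncard * μ.real {ω | y < ξ 0 ω}| := by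
  rw [← mul_sub, abs_mul, Nat.abs_cast]
  rcases le_total x y with h | h
  · exact probMaxLE_level_sub_le_of_le hξ hstat hA h
  · rw [abs_sub_comm, abs_sub_comm (μ.real _)]
    exact probMaxLE_level_sub_le_of_le hξ hstat hA h

/-! ### Blocks -/

/-- The lattice points `∏ l, [z_l t_l + g_l, (z_l + 1) t_l - g_l)` of the grid cell with index
`z`, shrunk by `g` on all sides. -/
def latticeBlock (t g z : Fin d → ℤ) : Set (Fin d → ℤ) :=
  Set.Icc (fun l => z l * t l + g l) (fun l => (z l + 1) * t l - 1 - g l)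

theorem mem_latticeBlock {t g z v : Fin d → ℤ} :
    v ∈ latticeBlock t g z ↔ ∀ l, z l * t l + g l ≤ v l ∧ v l + g l < (z l + 1) * t l := by
  rw [latticeBlock, Set.mem_Icc, Pi.le_def, Pi.le_def, ← forall_and]
  refine forall_congr' fun l => and_congr Iff.rfl ?_
  omega

theorem finite_latticeBlock (t g z : Fin d → ℤ) : (latticeBlock t g z).Finite :=
  Set.finite_Icc _ _

theorem ncard_latticeBlock {t g : Fin d → ℤ} (h : ∀ l, 2 * g l ≤ t l) (z : Fin d → ℤ) :
    ((latticeBlock t g z).ncard : ℝ) = ∏ l, ((t l : ℝ) - 2 * g l) := by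
  rw [latticeBlock, ← Finset.coe_Icc, Set.ncard_coe_finset, Pi.card_Icc, Nat.cast_prod]
  refine Finset.prod_congr rfl fun l _ => ?_
  have : ((((z l + 1) * t l - 1 - g l + 1 - (z l * t l + g l)).toNat : ℤ) : ℝ)
      = (t l : ℝ) - 2 * g l := by
    have h1 : (z l + 1) * t l - 1 - g l + 1 - (z l * t l + g l) = t l - 2 * g l := by ring
    rw [h1, Int.toNat_of_nonneg (by linarith [h l])]
    push_cast
    ring
  rw [Int.card_Icc]
  exact_mod_cast this

theorem latticeBlock_subset {t g z : Fin d → ℤ} (hg : ∀ l, 0 ≤ g l) :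
    latticeBlock t g z ⊆ latticeBlock t 0 z := by
  intro v hv
  rw [mem_latticeBlock] at hv ⊢
  intro l
  have := hv l
  have := hg l
  simp only [Pi.zero_apply]
  constructor <;> linarith

theorem IsStationary.probMaxLE_latticeBlock (hξ : ∀ v, Measurable (ξ v))
    (hstat : IsStationary μ ξ) (t g z : Fin d → ℤ) (x : ℝ) :
    probMaxLE μ ξ (latticeBlock t g z) x = probMaxLE μ ξ (latticeBlock t g 0) x := by
  refine hstat.probMaxLE_translate hξ (h := z * t) (fun v => ?_) x
  simp only [mem_latticeBlock, Pi.sub_apply, Pi.mul_apply, Pi.zero_apply]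
  refine forall_congr' fun l => and_congr ?_ ?_
  · constructor <;> intro h <;> linarith
  · constructor <;> intro h <;> linarith

/-- The ellipsoid lies in the box with half-widths `γ l`, so a larger gap in one coordinate
suffices. -/
theorem isSeparated_of_forall_exists {γ : Fin d → ℝ} (hγ : ∀ l, 0 < γ l)
    {A B : Set (Fin d → ℤ)}
    (h : ∀ a ∈ A, ∀ b ∈ B, ∃ l, γ l < |(b l : ℝ) - a l|) : IsSeparated γ A B := by
  rintro _ ⟨b, hb, rfl⟩ ⟨_, ⟨a, ha, rfl⟩, y, ⟨u, hu, hy⟩, hay⟩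
  obtain ⟨l, hl⟩ := h a ha b hb
  have h1 : (b l : ℝ) - a l = y l := by
    have := congrFun hay l
    simp only [toReal, Pi.add_apply] at this
    linarith
  have h2 : u l ^ 2 ≤ 1 :=
    (Finset.single_le_sum (fun i _ => sq_nonneg (u i)) (Finset.mem_univ l)).trans hu
  have h3 : |u l| ≤ 1 := abs_le_one_iff_mul_self_le_one.2 (by nlinarith)
  rw [h1, hy l, abs_mul, abs_of_pos (hγ l)] at hl
  nlinarith [hγ l]

/-- In a coordinate where the indices differ, each block keeps the distance `g l` from the common
wall. With `g = 0` this is disjointness. -/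
theorem exists_gap_of_latticeBlock {t g z z' a b : Fin d → ℤ} (ht : ∀ l, 0 ≤ t l)
    (hz : z ≠ z') (ha : a ∈ latticeBlock t g z) (hb : b ∈ latticeBlock t g z') :
    ∃ l, 2 * g l < |b l - a l| := by
  obtain ⟨l, hl⟩ := Function.ne_iff.1 hz
  have h1 := mem_latticeBlock.1 ha l
  have h2 := mem_latticeBlock.1 hb l
  refine ⟨l, ?_⟩
  have h3 := ht l
  rcases lt_or_gt_of_ne hl with h | h
  · rw [lt_abs]
    left
    have : (z l + 1) * t l ≤ z' l * t l := mul_le_mul_of_nonneg_right h h3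
    linarith
  · rw [lt_abs]
    right
    have : (z' l + 1) * t l ≤ z l * t l := mul_le_mul_of_nonneg_right h h3
    linarith

/-! ### Consequences of mixing for blocks. -/

/-- The mixing inequality at a fixed level. -/
def MixingAt (μ : Measure Ω) (ξ : (Fin d → ℤ) → Ω → ℝ) (K : Set (Fin d → ℤ)) (x a : ℝ)
    (γ : Fin d → ℝ) : Prop :=
  ∀ A B : Set (Fin d → ℤ), A ⊆ K → B ⊆ K → IsSeparated γ A B → IsBox A ∨ IsBox B →
    |probMaxLE μ ξ (A ∪ B) x - probMaxLE μ ξ A x * probMaxLE μ ξ B x| ≤ a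

/-- Passing to complements in both events leaves their covariance unchanged. -/
theorem MixingAt.measureReal_inter_le [IsProbabilityMeasure μ] (hξ : ∀ v, Measurable (ξ v))
    {K : Set (Fin d → ℤ)} {x a : ℝ} {γ : Fin d → ℝ} (hm : MixingAt μ ξ K x a γ)
    {A B : Set (Fin d → ℤ)} (hA : A ⊆ K) (hB : B ⊆ K) (hs : IsSeparated γ A B)
    (hbox : IsBox A ∨ IsBox B) :
    μ.real (exceedSet ξ A x ∩ exceedSet ξ B x)
      ≤ μ.real (exceedSet ξ A x) * μ.real (exceedSet ξ B x) + a := by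
  have h1 := (abs_le.1 (hm A B hA hB hs hbox)).2
  have h2 := measureReal_union_add_inter (μ := μ) (s := exceedSet ξ A x)
    (t := exceedSet ξ B x) (measurableSet_exceedSet hξ B x)
  rw [probMaxLE_eq hξ, probMaxLE_eq hξ, probMaxLE_eq hξ, exceedSet_union] at h1
  nlinarith

/-- Blocks are split off one at a time. The single block is the box required by the mixing
condition, so the remaining union may have any shape; each step costs `a`, and earlier errors do not
grow because `ρ ≤ 1`. -/
theorem MixingAt.abs_probMaxLE_biUnion_sub_pow_le [IsProbabilityMeasure μ]
    (hξ : ∀ v, Measurable (ξ v)) (hstat : IsStationary μ ξ)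
    {K : Set (Fin d → ℤ)} {x a : ℝ} {γ : Fin d → ℝ} (hm : MixingAt μ ξ K x a γ)
    (hγ : ∀ l, 0 < γ l) {t g : Fin d → ℤ} (ht : ∀ l, 0 ≤ t l) (hg : ∀ l, γ l ≤ g l)
    (Z : Finset (Fin d → ℤ)) (hZ : ∀ z ∈ Z, latticeBlock t g z ⊆ K) :
    |probMaxLE μ ξ (⋃ z ∈ Z, latticeBlock t g z) x
      - probMaxLE μ ξ (latticeBlock t g 0) x ^ Z.card| ≤ Z.card * a := by
  classical
  induction Z using Finset.induction_on with
  | empty => simp [probMaxLE_empty]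
  | insert z Z hz ih =>
    have ih := ih fun w hw => hZ w (Finset.mem_insert_of_mem hw)
    set ρ := probMaxLE μ ξ (latticeBlock t g 0) x
    have hsep : IsSeparated γ (latticeBlock t g z) (⋃ w ∈ Z, latticeBlock t g w) := by
      refine isSeparated_of_forall_exists hγ fun v hv b hb => ?_
      obtain ⟨w, hw, hb⟩ := Set.mem_iUnion₂.1 hb
      obtain ⟨l, hl⟩ := exists_gap_of_latticeBlock ht (ne_of_mem_of_not_mem hw hz).symm hv hb
      refine ⟨l, ?_⟩
      have h1 : (2 : ℝ) * g l < |(b l : ℝ) - v l| := by exact_mod_cast hl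
      linarith [hg l, hγ l]
    have h1 := hm _ _ (hZ z (Finset.mem_insert_self z Z))
      (Set.iUnion₂_subset fun w hw => hZ w (Finset.mem_insert_of_mem hw)) hsep
      (Or.inl ⟨_, _, rfl⟩)
    rw [hstat.probMaxLE_latticeBlock hξ t g z] at h1
    rw [Finset.set_biUnion_insert, Finset.card_insert_of_notMem hz, pow_succ]
    have hρ0 : 0 ≤ ρ := probMaxLE_nonneg _ _
    have hρ1 : ρ ≤ 1 := probMaxLE_le_one _ _
    rw [abs_le] at h1 ih ⊢
    push_cast
    constructor <;> nlinarith

/-- The union of the `3^d` blocks around the origin, which contains the points `j + v` with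
`j` in the block at the origin and `v` in `t [-1,1]^d`. -/
def enlargedBlock (t : Fin d → ℤ) : Set (Fin d → ℤ) :=
  Set.Icc (fun l => -t l) (fun l => 2 * t l - 1)

theorem ncard_enlargedBlock {t : Fin d → ℤ} (ht : ∀ l, 0 ≤ t l) :
    ((enlargedBlock t).ncard : ℝ) = 3 ^ d * ∏ l, (t l : ℝ) := by
  rw [enlargedBlock, ← Finset.coe_Icc, Set.ncard_coe_finset, Pi.card_Icc, Nat.cast_prod]
  have : ∀ l, ((Finset.Icc (-t l) (2 * t l - 1)).card : ℝ) = 3 * t l := by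
    intro l
    have : (((2 * t l - 1 + 1 - -t l).toNat : ℤ) : ℝ) = 3 * (t l : ℝ) := by
      rw [Int.toNat_of_nonneg (by linarith [ht l])]
      push_cast
      ring
    rw [Int.card_Icc]
    exact_mod_cast this
  rw [Finset.prod_congr rfl fun l _ => this l, Finset.prod_mul_distrib]
  simp

/-- The set of points of `t [-1,1]^d` that come after the origin. -/
def laterPoints (ord : LinearOrder (Fin d → ℤ)) (t : Fin d → ℤ) : Set (Fin d → ℤ) :=
  {z | (∀ l, |z l| ≤ t l) ∧ ord.lt 0 z}

/-- The event that `j` is an exceedance which is followed by no other one in `j + A`. -/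
def lastExceedSet (ξ : (Fin d → ℤ) → Ω → ℝ) (A : Set (Fin d → ℤ)) (x : ℝ)
    (j : Fin d → ℤ) : Set Ω :=
  {ω | x < ξ j ω ∧ ∀ v ∈ A, ξ (v + j) ω ≤ x}

theorem measurableSet_lastExceedSet (hξ : ∀ v, Measurable (ξ v)) (A : Set (Fin d → ℤ)) (x : ℝ)
    (j : Fin d → ℤ) : MeasurableSet (lastExceedSet ξ A x j) := by
  have : lastExceedSet ξ A x j = {ω | x < ξ j ω} ∩ ⋂ v ∈ A, {ω | ξ (v + j) ω ≤ x} := by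
    ext ω
    simp [lastExceedSet]
  rw [this]
  exact (measurableSet_lt measurable_const (hξ j)).inter
    (MeasurableSet.biInter A.to_countable fun v _ => measurableSet_le (hξ _) measurable_const)

theorem lt_iff_zero_lt_sub {ord : LinearOrder (Fin d → ℤ)}
    (hord : ∀ u v w : Fin d → ℤ, ord.lt u v → ord.lt (u + w) (v + w)) (u v : Fin d → ℤ) :
    ord.lt u v ↔ ord.lt 0 (v - u) := by
  constructor
  · intro h
    simpa [sub_eq_add_neg] using hord u v (-u) h
  · intro h
    simpa using hord 0 (v - u) u h

theorem sub_mem_laterPoints {ord : LinearOrder (Fin d → ℤ)}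
    (hord : ∀ u v w : Fin d → ℤ, ord.lt u v → ord.lt (u + w) (v + w)) {t i j : Fin d → ℤ}
    (hi : i ∈ latticeBlock t 0 0) (hj : j ∈ latticeBlock t 0 0) (hij : ord.lt i j) :
    j - i ∈ laterPoints ord t := by
  refine ⟨fun l => ?_, (lt_iff_zero_lt_sub hord i j).1 hij⟩
  have h1 := mem_latticeBlock.1 hi l
  have h2 := mem_latticeBlock.1 hj l
  simp only [Pi.zero_apply] at h1 h2
  rw [Pi.sub_apply, abs_le]
  constructor <;> linarith

/-- Lower bound of the block exceedance probability by its last exceedances. -/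
theorem card_mul_lastExceed_le [IsProbabilityMeasure μ] (hξ : ∀ v, Measurable (ξ v))
    (hstat : IsStationary μ ξ) {ord : LinearOrder (Fin d → ℤ)}
    (hord : ∀ u v w : Fin d → ℤ, ord.lt u v → ord.lt (u + w) (v + w)) (t : Fin d → ℤ) (x : ℝ) :
    (latticeBlock t 0 0).ncard * μ.real (lastExceedSet ξ (laterPoints ord t) x 0)
      ≤ μ.real (exceedSet ξ (latticeBlock t 0 0) x) := by
  have hJ := finite_latticeBlock t 0 0
  have h1 : ∀ j, μ.real (lastExceedSet ξ (laterPoints ord t) x j)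
      = μ.real (lastExceedSet ξ (laterPoints ord t) x 0) := by
    intro j
    have := hstat.exceed_last hξ (laterPoints ord t) j x
    simpa [lastExceedSet] using this
  -- If `i` precedes `j` in the same block, then `j - i` lies in `laterPoints ord t`, so an
  -- exceedance at `j` prevents `i` from being last.
  have hlt : ∀ i ∈ latticeBlock t 0 0, ∀ j ∈ latticeBlock t 0 0, ord.lt i j → ∀ ω,
      ω ∈ lastExceedSet ξ (laterPoints ord t) x i →
      ω ∉ lastExceedSet ξ (laterPoints ord t) x j := by
    intro i hi j hj hij ω hω hω'
    have := hω.2 _ (sub_mem_laterPoints hord hi hj hij)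
    rw [sub_add_cancel] at this
    exact absurd hω'.1 (not_lt.2 this)
  have h2 : μ.real (⋃ j ∈ hJ.toFinset, lastExceedSet ξ (laterPoints ord t) x j)
      = ∑ j ∈ hJ.toFinset, μ.real (lastExceedSet ξ (laterPoints ord t) x j) := by
    refine measureReal_biUnion_finset ?_ fun j _ => measurableSet_lastExceedSet hξ _ x j
    intro i hi j hj hij
    have hi : i ∈ latticeBlock t 0 0 := hJ.mem_toFinset.1 hi
    have hj : j ∈ latticeBlock t 0 0 := hJ.mem_toFinset.1 hj
    rw [Function.onFun, Set.disjoint_left]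
    intro ω hω hω'
    rcases @lt_or_gt_of_ne _ ord _ _ hij with h | h
    · exact hlt i hi j hj h ω hω hω'
    · exact hlt j hj i hi h ω hω' hω
  simp only [h1, Finset.sum_const, nsmul_eq_mul] at h2
  rw [Set.ncard_eq_toFinset_card _ hJ, ← h2]
  refine measureReal_mono (Set.iUnion₂_subset fun j hj ω hω => ?_)
  exact ⟨j, hJ.mem_toFinset.1 hj, hω.1⟩

/-- Upper bound of the block exceedance probability by its last exceedances. -/
theorem exceed_le_card_mul_lastExceed_add [IsProbabilityMeasure μ] (hξ : ∀ v, Measurable (ξ v))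
    (hstat : IsStationary μ ξ) {ord : LinearOrder (Fin d → ℤ)}
    (hord : ∀ u v w : Fin d → ℤ, ord.lt u v → ord.lt (u + w) (v + w)) (t : Fin d → ℤ) (x : ℝ) :
    μ.real (exceedSet ξ (latticeBlock t 0 0) x)
      ≤ (latticeBlock t 0 0).ncard * μ.real (lastExceedSet ξ (laterPoints ord t) x 0)
        + μ.real (exceedSet ξ (latticeBlock t 0 0) x ∩
          exceedSet ξ (enlargedBlock t \ latticeBlock t 0 0) x) := by
  classical
  have hJ := finite_latticeBlock t 0 0
  have h1 : ∀ j, μ.real (lastExceedSet ξ (laterPoints ord t) x j)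
      = μ.real (lastExceedSet ξ (laterPoints ord t) x 0) := by
    intro j
    have := hstat.exceed_last hξ (laterPoints ord t) j x
    simpa [lastExceedSet] using this
  have hsub : exceedSet ξ (latticeBlock t 0 0) x ⊆
      (⋃ j ∈ hJ.toFinset, lastExceedSet ξ (laterPoints ord t) x j) ∪
      (exceedSet ξ (latticeBlock t 0 0) x ∩
          exceedSet ξ (enlargedBlock t \ latticeBlock t 0 0) x) := by
    intro ω hω
    obtain ⟨v, hv, hxv⟩ := hω
    -- Take the last exceedance `j` of the block in the order `ord`. An exceedance that follows it
    -- within `j + t[-1,1]^d` lies in the enlarged block and, by maximality of `j`, outside the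
    -- block itself.
    obtain ⟨j, hj, hmax⟩ := @Finset.exists_max_image _ _ ord
      (hJ.toFinset.filter fun v => x < ξ v ω) id
      ⟨v, Finset.mem_filter.2 ⟨hJ.mem_toFinset.2 hv, hxv⟩⟩
    obtain ⟨hj, hxj⟩ := Finset.mem_filter.1 hj
    have hjJ : j ∈ latticeBlock t 0 0 := hJ.mem_toFinset.1 hj
    by_cases h : ω ∈ lastExceedSet ξ (laterPoints ord t) x j
    · exact Or.inl (Set.mem_biUnion hj h)
    · refine Or.inr ⟨⟨v, hv, hxv⟩, ?_⟩
      have : ∃ w ∈ laterPoints ord t, x < ξ (w + j) ω := by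
        by_contra! H
        exact h ⟨hxj, H⟩
      obtain ⟨w, hw, hxw⟩ := this
      refine ⟨w + j, ⟨?_, fun hwj => ?_⟩, hxw⟩
      · have hjm := mem_latticeBlock.1 hjJ
        simp only [Pi.zero_apply] at hjm
        refine ⟨fun l => ?_, fun l => ?_⟩
        · have := abs_le.1 (hw.1 l)
          have := hjm l
          simp only [Pi.add_apply]
          linarith
        · have := abs_le.1 (hw.1 l)
          have := hjm l
          simp only [Pi.add_apply]
          linarith
      · have h2 := hmax (w + j) (Finset.mem_filter.2 ⟨hJ.mem_toFinset.2 hwj, hxw⟩)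
        have h3 := hord 0 w j hw.2
        rw [zero_add] at h3
        exact absurd h3 (@not_lt_of_ge _ ord.toPreorder _ _ h2)
  have h2 := (measureReal_mono (μ := μ) hsub).trans (measureReal_union_le _ _)
  have h3 := measureReal_biUnion_finset_le (μ := μ) hJ.toFinset
    fun j => lastExceedSet ξ (laterPoints ord t) x j
  simp only [h1, Finset.sum_const, nsmul_eq_mul] at h3
  rw [Set.ncard_eq_toFinset_card _ hJ]
  linarith

/-- Bound of the probability of exceedances both in a block and in its surrounding. -/
theorem MixingAt.exceed_block_and_surrounding_le [IsProbabilityMeasure μ]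
    (hξ : ∀ v, Measurable (ξ v)) (hstat : IsStationary μ ξ)
    {K : Set (Fin d → ℤ)} {x a : ℝ} {γ : Fin d → ℝ} (hm : MixingAt μ ξ K x a γ)
    (hγ : ∀ l, 0 < γ l) {t g : Fin d → ℤ} (ht : ∀ l, 2 * g l ≤ t l) (hg : ∀ l, γ l ≤ g l)
    (hK : enlargedBlock t ⊆ K) :
    μ.real (exceedSet ξ (latticeBlock t 0 0) x ∩
          exceedSet ξ (enlargedBlock t \ latticeBlock t 0 0) x)
      ≤ 3 ^ d * ((∏ l, (t l : ℝ)) * μ.real {ω | x < ξ 0 ω}) ^ 2 + a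
        + (∏ l, (t l : ℝ) - ∏ l, ((t l : ℝ) - 2 * g l)) * μ.real {ω | x < ξ 0 ω} := by
  have hg0 : ∀ l, 0 < g l := fun l => by exact_mod_cast (hγ l).trans_le (hg l)
  have ht0 : ∀ l, 0 ≤ t l := fun l => by linarith [hg0 l, ht l]
  have hsub : latticeBlock t g 0 ⊆ latticeBlock t 0 0 := latticeBlock_subset fun l => (hg0 l).le
  have hsub' : latticeBlock t 0 0 ⊆ enlargedBlock t := by
    intro v hv
    rw [mem_latticeBlock] at hv
    simp only [Pi.zero_apply] at hv
    refine ⟨fun l => ?_, fun l => ?_⟩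
    · linarith [hv l, ht0 l]
    · linarith [hv l, ht0 l]
  set J := latticeBlock t 0 0
  set J' := latticeBlock t g 0
  set B := enlargedBlock t \ J
  have hBfin : (enlargedBlock t).Finite := Set.finite_Icc _ _
  -- The surrounding is not a box, but the shrunken block is. A point outside `J` leaves it through
  -- some coordinate and is there more than `g l` away from `J'`.
  have hsep : IsSeparated γ J' B := by
    refine isSeparated_of_forall_exists hγ fun v hv b hb => ?_
    have hb2 : b ∉ J := hb.2
    rw [mem_latticeBlock] at hb2
    push Not at hb2
    obtain ⟨l, hl⟩ := hb2
    have hvl := mem_latticeBlock.1 hv l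
    simp only [Pi.zero_apply] at hl hvl
    refine ⟨l, (hg l).trans_lt ?_⟩
    have : g l < |b l - v l| := by
      rw [lt_abs]
      by_cases h : 0 ≤ b l
      · left
        have := hl (by linarith)
        linarith
      · right
        linarith
    exact_mod_cast this
  have h1 := hm.measureReal_inter_le hξ (hsub.trans (hsub'.trans hK))
    (Set.sdiff_subset.trans hK) hsep (Or.inl ⟨_, _, rfl⟩)
  set p := μ.real {ω | x < ξ 0 ω}
  have hp : 0 ≤ p := measureReal_nonneg
  have hJ : (J.ncard : ℝ) = ∏ l, (t l : ℝ) := by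
    rw [ncard_latticeBlock (by simpa using ht0)]
    simp
  have hJ' : (J'.ncard : ℝ) = ∏ l, ((t l : ℝ) - 2 * g l) := ncard_latticeBlock ht 0
  have h2 : μ.real (exceedSet ξ J' x) ≤ (∏ l, (t l : ℝ)) * p := by
    refine (measureReal_exceedSet_le hξ hstat (finite_latticeBlock _ _ _) x).trans ?_
    rw [← hJ]
    gcongr
    exact finite_latticeBlock _ _ _
  have h3 : μ.real (exceedSet ξ B x) ≤ 3 ^ d * (∏ l, (t l : ℝ)) * p := by
    refine (measureReal_exceedSet_le hξ hstat (hBfin.subset Set.sdiff_subset) x).trans ?_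
    rw [← ncard_enlargedBlock ht0]
    gcongr
    exact Set.sdiff_subset
  have h4 : μ.real (exceedSet ξ (J \ J') x)
      ≤ (∏ l, (t l : ℝ) - ∏ l, ((t l : ℝ) - 2 * g l)) * p := by
    refine (measureReal_exceedSet_le hξ hstat
      ((finite_latticeBlock t 0 0).subset Set.sdiff_subset) x).trans ?_
    rw [← hJ, ← hJ']
    have : ((J \ J').ncard : ℝ) = J.ncard - J'.ncard := by
      rw [eq_sub_iff_add_eq]
      exact_mod_cast Set.ncard_sdiff_add_ncard_of_subset hsub (finite_latticeBlock t 0 0)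
    rw [this]
  -- Exceedances in the removed layer `J \ J'` are handled by a union bound, which produces the
  -- border term.
  have h5 : exceedSet ξ J x ∩ exceedSet ξ B x ⊆
      (exceedSet ξ J' x ∩ exceedSet ξ B x) ∪ exceedSet ξ (J \ J') x := by
    rintro ω ⟨hω, hω'⟩
    rw [← Set.union_sdiff_cancel hsub, exceedSet_union] at hω
    rcases hω with hω | hω
    · exact Or.inl ⟨hω, hω'⟩
    · exact Or.inr hω
  have h6 := (measureReal_mono (μ := μ) h5).trans (measureReal_union_le _ _)
  have h7 : μ.real (exceedSet ξ J' x) * μ.real (exceedSet ξ B x)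
      ≤ ((∏ l, (t l : ℝ)) * p) * (3 ^ d * (∏ l, (t l : ℝ)) * p) := by
    have : 0 ≤ ∏ l, (t l : ℝ) := hJ ▸ Nat.cast_nonneg _
    gcongr
  have h8 : ((∏ l, (t l : ℝ)) * p) * (3 ^ d * (∏ l, (t l : ℝ)) * p)
      = 3 ^ d * ((∏ l, (t l : ℝ)) * p) ^ 2 := by ring
  linarith

end Field

end SpatialExtremes

namespace SpatialExtremes

/-! ### Asymptotic cell counts -/

section Counting

variable {d p : ℕ} {D : ℕ → Set (Fin d → ℤ)} {C : ℕ → Set (Fin d → ℝ)} {c : ℕ → Fin d → ℝ}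

theorem IndexSetAssumption.prod_scaling_pos (hD : IndexSetAssumption p D C c) (n : ℕ) :
    0 < ∏ l, c n l :=
  Finset.prod_pos fun l _ => hD.scaling_pos n l

theorem IndexSetAssumption.finite_meetingCells (hD : IndexSetAssumption p D C c) (n : ℕ)
    {t : Fin d → ℝ} (ht : ∀ l, 0 < t l) : (meetingCells t (C n)).Finite := by
  obtain ⟨a, -, haC⟩ := hD.subset_box
  exact SpatialExtremes.finite_meetingCells ht (r := fun l => a * c n l) (haC n)

theorem IndexSetAssumption.tendsto_card_boundaryCells (hD : IndexSetAssumption p D C c)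
    {t : ℕ → Fin d → ℝ} (ht : ∀ᶠ n in atTop, ∀ l, 0 < t n l)
    (htc : ∀ l, Tendsto (fun n => t n l / c n l) atTop (𝓝 0)) :
    Tendsto (fun n => (boundaryCells (t n) (C n)).ncard * (∏ l, t n l) / ∏ l, c n l)
      atTop (𝓝 0) := by
  obtain ⟨a, ha, haC⟩ := hD.subset_box
  rw [tendsto_order]
  refine ⟨fun b hb => ?_, fun ε hε => ?_⟩
  · filter_upwards [ht] with n hn
    refine hb.trans_le (div_nonneg (mul_nonneg (Nat.cast_nonneg _) ?_) (hD.prod_scaling_pos n).le)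
    exact Finset.prod_nonneg fun l _ => (hn l).le
  -- The count gives the bound `Q / J` for the quotient: 5(ac/t + 1)t ≤ 10ac as soon as t ≤ ac.
  -- Choosing `J > Q / ε` brings it below `ε`.
  · set Q : ℝ := p * 2 ^ d * (10 * a) ^ d
    obtain ⟨J, hJ⟩ := exists_nat_gt (max 1 (Q / ε))
    have hJ1 : (1 : ℝ) < J := (le_max_left _ _).trans_lt hJ
    have hJQ : Q < J * ε := by
      rw [← div_lt_iff₀ hε]
      exact (le_max_right _ _).trans_lt hJ
    have hJ1' : 1 ≤ J := by exact_mod_cast hJ1.le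
    -- This makes the cells small enough both for the requirement on `J` in the count and for t ≤
    -- ac.
    have hsmall : ∀ᶠ n in atTop, ∀ l, t n l / c n l < a / J := by
      rw [eventually_all]
      exact fun l => (htc l).eventually_lt_const (by positivity)
    filter_upwards [ht, hsmall] with n hn hs
    have hcn := hD.scaling_pos n
    have h1 : ∀ l, J * t n l ≤ a * c n l := by
      intro l
      have := (div_lt_div_iff₀ (hcn l) (by linarith)).1 (hs l)
      linarith
    have h2 : ∀ l, t n l ≤ a * c n l := by
      intro l
      nlinarith [h1 l, hn l]
    have hb := card_boundaryCells_le_of_isPConvex hn (hD.pconvex n)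
      (r := fun l => a * c n l) (haC n) J hJ1' (fun l => by
        have := (le_div_iff₀ (hn l)).2 (h1 l)
        linarith)
    have htpos : 0 < ∏ l, t n l := Finset.prod_pos fun l _ => hn l
    have h3 : (∏ l, (5 * (a * c n l / t n l + 1))) * ∏ l, t n l
        ≤ (10 * a) ^ d * ∏ l, c n l := by
      have : (10 * a) ^ d * ∏ l, c n l = ∏ l, (10 * a * c n l) := by
        rw [Finset.prod_mul_distrib]
        simp
      rw [this, ← Finset.prod_mul_distrib]
      refine Finset.prod_le_prod (fun l _ => ?_) fun l _ => ?_
      · have := hn l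
        have := hcn l
        positivity
      · have h4 : a * c n l / t n l * t n l = a * c n l := div_mul_cancel₀ _ (hn l).ne'
        have h5 := h2 l
        calc 5 * (a * c n l / t n l + 1) * t n l
            = 5 * (a * c n l / t n l * t n l) + 5 * t n l := by ring
          _ ≤ 10 * a * c n l := by rw [h4]; linarith
    rw [div_lt_iff₀ (hD.prod_scaling_pos n)]
    have h6 : (J : ℝ) * ((boundaryCells (t n) (C n)).ncard * ∏ l, t n l)
        ≤ Q * ∏ l, c n l := by
      calc (J : ℝ) * ((boundaryCells (t n) (C n)).ncard * ∏ l, t n l)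
          = (J * (boundaryCells (t n) (C n)).ncard) * ∏ l, t n l := by ring
        _ ≤ (p * (2 ^ d * ∏ l, (5 * (a * c n l / t n l + 1)))) * ∏ l, t n l := by gcongr
        _ = p * 2 ^ d * ((∏ l, (5 * (a * c n l / t n l + 1))) * ∏ l, t n l) := by ring
        _ ≤ p * 2 ^ d * ((10 * a) ^ d * ∏ l, c n l) := by gcongr
        _ = Q * ∏ l, c n l := by ring
    have h7 := hD.prod_scaling_pos n
    nlinarith

theorem IndexSetAssumption.tendsto_volume_div (hD : IndexSetAssumption p D C c) :
    Tendsto (fun n => volume.real (C n) / ∏ l, c n l) atTop (𝓝 1) := by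
  have h := (Asymptotics.isEquivalent_iff_tendsto_one
    (Eventually.of_forall fun n => (hD.prod_scaling_pos n).ne')).1 hD.scaling_equiv.symm
  exact h

theorem IndexSetAssumption.volume_ne_top (hD : IndexSetAssumption p D C c) (n : ℕ) :
    volume (C n) ≠ ⊤ := by
  obtain ⟨body, hbody, h⟩ := hD.pconvex n
  rw [h]
  exact (isCompact_iUnion fun i => (hbody i).1).measure_lt_top.ne

/-- The volume lies between the total volumes of the inner and of the meeting cells, which differ by
the boundary cells only. -/
theorem IndexSetAssumption.tendsto_card_meetingCells (hD : IndexSetAssumption p D C c)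
    {t : ℕ → Fin d → ℝ} (ht : ∀ᶠ n in atTop, ∀ l, 0 < t n l)
    (htc : ∀ l, Tendsto (fun n => t n l / c n l) atTop (𝓝 0)) :
    Tendsto (fun n => (meetingCells (t n) (C n)).ncard * (∏ l, t n l) / ∏ l, c n l)
      atTop (𝓝 1) := by
  have hb := hD.tendsto_card_boundaryCells ht htc
  have hv := hD.tendsto_volume_div
  have hu := hv.add hb
  rw [add_zero] at hu
  refine tendsto_of_tendsto_of_tendsto_of_le_of_le' hv hu ?_ ?_
  · filter_upwards [ht] with n hn
    have := hD.prod_scaling_pos n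
    gcongr
    exact volume_le_card_meetingCells_mul hn (hD.finite_meetingCells n hn)
  · filter_upwards [ht] with n hn
    have := hD.prod_scaling_pos n
    rw [← add_div]
    gcongr
    have hf := hD.finite_meetingCells n hn
    rw [card_meetingCells_eq hn hf]
    push_cast
    rw [add_mul]
    gcongr
    exact card_innerCells_mul_le_volume hn (hD.volume_ne_top n)
      (hf.subset (innerCells_subset_meetingCells hn _))

theorem toReal_mem_gridCell_one {d : ℕ} (z : Fin d → ℤ) : toReal z ∈ gridCell 1 z := by
  intro l
  simp [toReal]

theorem IndexSetAssumption.subset_meetingCells_one (hD : IndexSetAssumption p D C c) (n : ℕ) :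
    D n ⊆ meetingCells 1 (C n) := by
  intro z hz
  rw [hD.index_eq] at hz
  exact ⟨_, toReal_mem_gridCell_one z, hz⟩

theorem IndexSetAssumption.finite (hD : IndexSetAssumption p D C c) (n : ℕ) : (D n).Finite :=
  (hD.finite_meetingCells n fun _ => one_pos).subset (hD.subset_meetingCells_one n)

/-- Unit cells turn lattice points into cells: each lattice point is the lower corner of its own
cell, so `D n` lies between the inner and the meeting cells. -/
theorem IndexSetAssumption.tendsto_card (hD : IndexSetAssumption p D C c) :
    Tendsto (fun n => ((D n).ncard : ℝ) / ∏ l, c n l) atTop (𝓝 1) := by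
  have ht : ∀ᶠ n : ℕ in atTop, ∀ l : Fin d, 0 < (fun _ => 1 : ℕ → Fin d → ℝ) n l :=
    Eventually.of_forall fun n l => one_pos
  have htc : ∀ l, Tendsto (fun n => (fun _ => 1 : ℕ → Fin d → ℝ) n l / c n l) atTop (𝓝 0) := by
    intro l
    simp only [Pi.one_apply, one_div]
    exact (hD.scaling_tendsto l).inv_tendsto_atTop
  have hm := hD.tendsto_card_meetingCells ht htc
  have hb := hD.tendsto_card_boundaryCells ht htc
  have hl := hm.sub hb
  simp only [Pi.one_apply, Finset.prod_const_one, mul_one, sub_zero] at hm hl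
  refine tendsto_of_tendsto_of_tendsto_of_le_of_le hl hm (fun n => ?_) (fun n => ?_)
  · have := hD.prod_scaling_pos n
    have hf := hD.finite_meetingCells n (t := 1) fun _ => one_pos
    simp only
    rw [← sub_div]
    gcongr
    rw [card_meetingCells_eq (t := 1) (fun _ => one_pos) hf]
    push_cast
    rw [add_sub_cancel_right]
    have : innerCells 1 (C n) ⊆ D n := by
      intro z hz
      rw [hD.index_eq]
      exact hz (toReal_mem_gridCell_one z)
    exact_mod_cast Set.ncard_le_ncard this (hD.finite n)
  · have := hD.prod_scaling_pos n
    have hf := hD.finite_meetingCells n (t := 1) fun _ => one_pos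
    simp only
    gcongr
    exact hD.subset_meetingCells_one n

/-! ### The outer approximation as a union of lattice blocks. -/

theorem latticePoints_cell (c : Fin d → ℝ) (k : ℕ) (z : Fin d → ℤ) :
    latticePoints (cell c k z) = latticeBlock (sideLength c k) 0 z := by
  ext v
  rw [mem_latticeBlock]
  refine forall_congr' fun l => ?_
  simp only [toReal, Pi.zero_apply, add_zero]
  norm_cast

theorem outerApprox_eq (S : Set (Fin d → ℝ)) (c : Fin d → ℝ) (k : ℕ) :
    outerApprox S c k
      = ⋃ z ∈ meetingCells (fun l => (sideLength c k l : ℝ)) S,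
        latticeBlock (sideLength c k) 0 z := by
  simp only [outerApprox, latticePoints_cell]
  rfl

theorem latticePoints_subset_outerApprox {S : Set (Fin d → ℝ)} {c : Fin d → ℝ} {k : ℕ}
    (ht : ∀ l, 0 < sideLength c k l) : latticePoints S ⊆ outerApprox S c k := by
  intro v hv
  have ht' : ∀ l, 0 < ((sideLength c k l : ℤ) : ℝ) := fun l => by exact_mod_cast ht l
  have h : toReal v ∈ cell c k (cellIndex (fun l => (sideLength c k l : ℝ)) (toReal v)) :=
    (mem_gridCell_iff ht').2 rfl
  exact Set.mem_biUnion (show _ ∈ {z | (cell c k z ∩ S).Nonempty} from ⟨_, h, hv⟩) h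

end Counting

/-! ### Elementary inequalities -/

theorem abs_pow_sub_pow_le_mul {a b : ℝ} (ha0 : 0 ≤ a) (ha : a ≤ 1) (hb0 : 0 ≤ b) (hb : b ≤ 1)
    (m : ℕ) : |a ^ m - b ^ m| ≤ m * |a - b| := by
  induction m with
  | zero => simp
  | succ m ih =>
    have h1 : a ^ (m + 1) - b ^ (m + 1) = a * (a ^ m - b ^ m) + b ^ m * (a - b) := by ring
    have h2 : |a * (a ^ m - b ^ m)| ≤ m * |a - b| := by
      rw [abs_mul, abs_of_nonneg ha0]
      exact (mul_le_of_le_one_left (abs_nonneg _) ha).trans ih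
    have h3 : |b ^ m * (a - b)| ≤ |a - b| := by
      rw [abs_mul, abs_of_nonneg (pow_nonneg hb0 m)]
      exact mul_le_of_le_one_left (abs_nonneg _) (pow_le_one₀ hb0 hb)
    rw [h1]
    push_cast
    linarith [abs_add_le (a * (a ^ m - b ^ m)) (b ^ m * (a - b))]

theorem abs_exp_neg_sub_exp_neg_le {u v : ℝ} (hu : 0 ≤ u) (hv : 0 ≤ v) :
    |Real.exp (-u) - Real.exp (-v)| ≤ |u - v| := by
  have key : ∀ {u v : ℝ}, 0 ≤ u → u ≤ v →
      |Real.exp (-u) - Real.exp (-v)| ≤ |u - v| := by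
    intro u v hu huv
    have h1 : Real.exp (-v) = Real.exp (-u) * Real.exp (u - v) := by
      rw [← Real.exp_add]
      congr 1
      ring
    have h2 := Real.add_one_le_exp (u - v)
    have h3 : Real.exp (-u) ≤ 1 := Real.exp_le_one_iff.2 (by linarith)
    have h4 : Real.exp (u - v) ≤ 1 := Real.exp_le_one_iff.2 (by linarith)
    have h5 := Real.exp_pos (-u)
    rw [h1, abs_of_nonneg (by nlinarith), abs_of_nonpos (by linarith)]
    nlinarith
  rcases le_total u v with h | h
  · exact key hu h
  · rw [abs_sub_comm, abs_sub_comm u]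
    exact key hv h

/-- The second-order error of `1 - q` against `exp (-q)` is multiplied by at most `m` on taking
powers of numbers in [0, 1]. -/
theorem abs_one_sub_pow_sub_exp_le {q : ℝ} (hq0 : 0 ≤ q) (hq : q ≤ 1) (m : ℕ) :
    |(1 - q) ^ m - Real.exp (-(m * q))| ≤ m * q ^ 2 := by
  have h1 : Real.exp (-(m * q)) = Real.exp (-q) ^ m := by
    rw [← Real.exp_nat_mul]
    congr 1
    ring
  have h2 := Real.abs_exp_sub_one_sub_id_le (x := -q) (by rwa [abs_neg, abs_of_nonneg hq0])
  rw [h1]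
  refine (abs_pow_sub_pow_le_mul (by linarith) (by linarith) (Real.exp_pos _).le
    (Real.exp_le_one_iff.2 (by linarith)) m).trans ?_
  gcongr
  rw [abs_sub_comm]
  calc |Real.exp (-q) - (1 - q)| = |Real.exp (-q) - 1 - -q| := by congr 1; ring
    _ ≤ (-q) ^ 2 := h2
    _ = q ^ 2 := by ring

/-! ### Poisson approximation -/

section Poisson

variable {d : ℕ} {Ω : Type*} [MeasurableSpace Ω] {μ : Measure Ω}
  {ξ : (Fin d → ℤ) → Ω → ℝ}

/-- Non-asymptotic comparison of the law of the maximum over a set that is nearly a union of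
blocks with the exponential of the conditional non-exceedance probability. -/
theorem MixingAt.abs_probMaxLE_sub_exp_le [IsProbabilityMeasure μ]
    (hξ : ∀ v, Measurable (ξ v)) (hstat : IsStationary μ ξ) {ord : LinearOrder (Fin d → ℤ)}
    (hord : ∀ u v w : Fin d → ℤ, ord.lt u v → ord.lt (u + w) (v + w))
    {K : Set (Fin d → ℤ)} {x a : ℝ} {γ : Fin d → ℝ} (hm : MixingAt μ ξ K x a γ)
    (hγ : ∀ l, 0 < γ l) {t g : Fin d → ℤ} (ht : ∀ l, 2 * g l ≤ t l) (hg : ∀ l, γ l ≤ g l)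
    (hK : enlargedBlock t ⊆ K) (Z : Finset (Fin d → ℤ))
    (hZ : (⋃ z ∈ Z, latticeBlock t 0 z) ⊆ K) {D : Set (Fin d → ℤ)}
    (hDZ : D ⊆ ⋃ z ∈ Z, latticeBlock t 0 z) (k : ℕ) {P N b : ℝ}
    (hP : P = μ.real {ω | x < ξ 0 ω}) (hN : N = ∏ l, (t l : ℝ))
    (hb : b = ∏ l, (t l : ℝ) - ∏ l, ((t l : ℝ) - 2 * g l)) {τ r : ℝ} (hτ : 0 ≤ τ)
    (hr0 : 0 ≤ r) (hr1 : r ≤ 1)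
    (hr : μ.real (lastExceedSet ξ (laterPoints ord t) x 0) = P * r) :
    |probMaxLE μ ξ D x - Real.exp (-(τ * r))|
      ≤ (Z.card * N - D.ncard) * P + Z.card * (b * P) + Z.card * a + Z.card * (b * P)
        + Z.card * (N * P) ^ 2 + |(Z.card : ℝ) - k| * (N * P)
        + k * (3 ^ d * (N * P) ^ 2 + a + b * P) + |k * (N * P) - τ| := by
  classical
  have hg0 : ∀ l, 0 < g l := fun l => by exact_mod_cast (hγ l).trans_le (hg l)
  have ht0 : ∀ l, 0 ≤ t l := fun l => by linarith [hg0 l, ht l]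
  have hblk : ∀ z, ((latticeBlock t 0 z).ncard : ℝ) = N := by
    intro z
    rw [ncard_latticeBlock (by simpa using ht0), hN]
    simp
  have hblk' : ∀ z, ((latticeBlock t g z).ncard : ℝ) = N - b := by
    intro z
    rw [ncard_latticeBlock ht, hN, hb]
    ring
  have hP0 : 0 ≤ P := hP ▸ measureReal_nonneg
  have hN0 : 0 ≤ N := hblk 0 ▸ Nat.cast_nonneg _
  have hbN : b ≤ N := by
    have : 0 ≤ N - b := hblk' 0 ▸ Nat.cast_nonneg _
    linarith
  set m := Z.card
  have hdisj : ∀ g' : Fin d → ℤ, (∀ l, 0 ≤ g' l) → ∀ z z', z ≠ z' →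
      Disjoint (latticeBlock t g' z) (latticeBlock t g' z') := by
    intro g' hg' z z' hzz
    rw [Set.disjoint_left]
    intro v hv hv'
    obtain ⟨l, hl⟩ := exists_gap_of_latticeBlock ht0 hzz hv hv'
    simp only [sub_self, abs_zero] at hl
    linarith [hg' l]
  have hcardU : ∀ g' : Fin d → ℤ, (∀ l, 0 ≤ g' l) → ∀ M : ℝ,
      (∀ z, ((latticeBlock t g' z).ncard : ℝ) = M) →
      ((⋃ z ∈ Z, latticeBlock t g' z).ncard : ℝ) = m * M := by
    intro g' hg' M hM
    have : (⋃ z ∈ Z, latticeBlock t g' z).ncard = ∑ z ∈ Z, (latticeBlock t g' z).ncard := by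
      have h1 : (⋃ z ∈ Z, latticeBlock t g' z)
          = ((Z.biUnion fun z => (finite_latticeBlock t g' z).toFinset : Finset (Fin d → ℤ))
            : Set (Fin d → ℤ)) := by
        ext v
        simp
      rw [h1, Set.ncard_coe_finset, Finset.card_biUnion]
      · exact Finset.sum_congr rfl fun z _ => (Set.ncard_eq_toFinset_card _ _).symm
      · intro z _ z' _ hzz
        rw [Function.onFun, Set.Finite.disjoint_toFinset]
        exact hdisj g' hg' z z' hzz
    rw [this]
    push_cast
    simp [hM, m]
  have hfin : (⋃ z ∈ Z, latticeBlock t 0 z).Finite :=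
    Z.finite_toSet.biUnion fun z _ => finite_latticeBlock t 0 z
  have hsubU : (⋃ z ∈ Z, latticeBlock t g z) ⊆ ⋃ z ∈ Z, latticeBlock t 0 z :=
    Set.iUnion₂_mono fun z _ => latticeBlock_subset fun l => (hg0 l).le
  -- A chain of eight comparisons, `e1` to `e8`: `D` with the full blocks, full with shrunken
  -- blocks, their union with a power, back to full blocks inside the power, `(1 - q) ^ m` with
  -- exp(-mq), `m` with `k`, `q` with `N P r`, and `k N P` with `τ`.
  have e1 := probMaxLE_sub_le (x := x) hξ hstat hDZ hfin
  rw [hcardU 0 (fun _ => le_rfl) N hblk, ← hP] at e1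
  have e2 := probMaxLE_sub_le (x := x) hξ hstat hsubU hfin
  rw [hcardU 0 (fun _ => le_rfl) N hblk, hcardU g (fun l => (hg0 l).le) _ hblk', ← hP] at e2
  have e3 := hm.abs_probMaxLE_biUnion_sub_pow_le hξ hstat hγ ht0 hg Z
    fun z hz => (Set.subset_biUnion_of_mem (u := fun z => latticeBlock t g z)
      (Finset.mem_coe.2 hz)).trans (hsubU.trans hZ)
  have e4 := probMaxLE_sub_le (x := x) hξ hstat
    (latticeBlock_subset (t := t) (z := 0) fun l => (hg0 l).le) (finite_latticeBlock t 0 0)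
  rw [hblk, hblk', ← hP] at e4
  have e4' := abs_pow_sub_pow_le_mul
    (probMaxLE_nonneg (μ := μ) (ξ := ξ) (latticeBlock t g 0) x)
    (probMaxLE_le_one (μ := μ) (ξ := ξ) (latticeBlock t g 0) x)
    (probMaxLE_nonneg (μ := μ) (ξ := ξ) (latticeBlock t 0 0) x)
    (probMaxLE_le_one (μ := μ) (ξ := ξ) (latticeBlock t 0 0) x) m
  have e4'' := e4'.trans (mul_le_mul_of_nonneg_left e4 (Nat.cast_nonneg m))
  rw [probMaxLE_eq hξ (latticeBlock t 0 0) x] at e4''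
  set q := μ.real (exceedSet ξ (latticeBlock t 0 0) x)
  have hq0 : 0 ≤ q := measureReal_nonneg
  have hq1 : q ≤ 1 := measureReal_le_one
  have hqN : q ≤ N * P := by
    have := measureReal_exceedSet_le (μ := μ) hξ hstat (finite_latticeBlock t 0 0) x
    rwa [hblk, ← hP] at this
  have e5 := abs_one_sub_pow_sub_exp_le hq0 hq1 m
  have e5' : (m : ℝ) * q ^ 2 ≤ m * (N * P) ^ 2 := by gcongr
  have e6 := abs_exp_neg_sub_exp_neg_le (u := m * q) (v := k * q) (by positivity)
    (by positivity)
  have e6' : |(m : ℝ) * q - k * q| ≤ |(m : ℝ) - k| * (N * P) := by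
    rw [← sub_mul, abs_mul, abs_of_nonneg hq0]
    gcongr
  have l1 := card_mul_lastExceed_le (μ := μ) hξ hstat hord t x
  have l2 := exceed_le_card_mul_lastExceed_add (μ := μ) hξ hstat hord t x
  have l3 := hm.exceed_block_and_surrounding_le hξ hstat hγ ht hg hK
  rw [hr, hblk] at l1 l2
  rw [← hN, ← hP, hN, ← hb, ← hN] at l3
  have e7 := abs_exp_neg_sub_exp_neg_le (u := k * q) (v := k * (N * (P * r))) (by positivity)
    (by positivity)
  have e7' : |k * q - k * (N * (P * r))| ≤ k * (3 ^ d * (N * P) ^ 2 + a + b * P) := by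
    rw [← mul_sub, abs_mul, Nat.abs_cast, abs_of_nonneg (by linarith)]
    gcongr
    linarith
  have e8 := abs_exp_neg_sub_exp_neg_le (u := k * (N * (P * r))) (v := τ * r) (by positivity)
    (by positivity)
  have e8' : |k * (N * (P * r)) - τ * r| ≤ |k * (N * P) - τ| := by
    have : k * (N * (P * r)) - τ * r = (k * (N * P) - τ) * r := by ring
    rw [this, abs_mul, abs_of_nonneg hr0]
    exact mul_le_of_le_one_right (abs_nonneg _) hr1
  rw [abs_sub_comm] at e2
  have f2 : (m * N - m * (N - b)) * P = m * (b * P) := by ring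
  have f4 : (m : ℝ) * ((N - (N - b)) * P) = m * (b * P) := by ring
  rw [f2] at e2
  rw [f4] at e4''
  have e5 := e5.trans e5'
  have e6 := e6.trans e6'
  have e7 := e7.trans e7'
  have e8 := e8.trans e8'
  rw [abs_le] at e1 e2 e3 e4'' e5 e6 e7 e8 ⊢
  constructor <;> linarith

end Poisson

end SpatialExtremes

namespace SpatialExtremes

/-! ### Asymptotics of the block sizes -/

section Asymptotics

variable {d p : ℕ} {D : ℕ → Set (Fin d → ℤ)} {C : ℕ → Set (Fin d → ℝ)} {c : ℕ → Fin d → ℝ}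

theorem tendsto_floor_div_self {u : ℕ → ℝ} (hu : Tendsto u atTop atTop) :
    Tendsto (fun n => (⌊u n⌋ : ℝ) / u n) atTop (𝓝 1) := by
  have h1 : Tendsto (fun n => 1 - (u n)⁻¹) atTop (𝓝 1) := by
    simpa using (tendsto_const_nhds (x := (1 : ℝ))).sub hu.inv_tendsto_atTop
  refine tendsto_of_tendsto_of_tendsto_of_le_of_le' h1 tendsto_const_nhds ?_ ?_
  · filter_upwards [hu.eventually_gt_atTop 0] with n hn
    rw [le_div_iff₀ hn, sub_mul, inv_mul_cancel₀ hn.ne', one_mul]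
    exact (Int.sub_one_lt_floor (u n)).le
  · filter_upwards [hu.eventually_gt_atTop 0] with n hn
    exact (div_le_one hn).2 (Int.floor_le _)

variable {α : ℕ → ℝ} {γ : ℕ → Fin d → ℝ} {k : ℕ → ℕ}

theorem IsAdmissible.root_pos (hk : IsAdmissible c α γ k) (n : ℕ) :
    0 < (k n : ℝ) ^ (1 / (d : ℝ)) :=
  Real.rpow_pos_of_pos (by exact_mod_cast hk.one_le n) _

theorem IsAdmissible.tendsto_root (hd : 1 ≤ d) (hk : IsAdmissible c α γ k) :
    Tendsto (fun n => (k n : ℝ) ^ (1 / (d : ℝ))) atTop atTop := by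
  have hd' : (0 : ℝ) < d := by exact_mod_cast hd
  exact (tendsto_rpow_atTop (one_div_pos.2 hd')).comp
    (tendsto_natCast_atTop_atTop.comp hk.tendsto_atTop)

/-- Monotonicity bounds `γ n l` below by `γ 0 l > 0`, so k^{1/d} γ_n = o(c_n) already forces k^{1/d}
= o(c_n). -/
theorem IsAdmissible.tendsto_side (hk : IsAdmissible c α γ k) (hc : ∀ n l, 0 < c n l)
    (hγ : ∀ n l, 0 < γ n l) (hmono : Monotone γ) (l : Fin d) :
    Tendsto (fun n => c n l / (k n : ℝ) ^ (1 / (d : ℝ))) atTop atTop := by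
  have h1 : Tendsto (fun n => (k n : ℝ) ^ (1 / (d : ℝ)) / c n l) atTop (𝓝 0) := by
    have h2 : Tendsto (fun n => (k n : ℝ) ^ (1 / (d : ℝ)) * γ n l / c n l / γ 0 l) atTop
        (𝓝 0) := by
      simpa using (hk.sep l).div_const (γ 0 l)
    refine squeeze_zero (fun n => (div_pos (hk.root_pos n) (hc n l)).le) (fun n => ?_) h2
    have h3 := hγ 0 l
    have h4 := hmono (Nat.zero_le n) l
    have h5 := hc n l
    have h6 := hk.root_pos n
    rw [le_div_iff₀ h3, div_mul_eq_mul_div]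
    gcongr
  have h2 : Tendsto (fun n => (k n : ℝ) ^ (1 / (d : ℝ)) / c n l) atTop (𝓝[>] 0) :=
    tendsto_nhdsWithin_iff.2 ⟨h1, Eventually.of_forall fun n =>
      div_pos (hk.root_pos n) (hc n l)⟩
  refine (tendsto_inv_nhdsGT_zero.comp h2).congr fun n => ?_
  simp

theorem IsAdmissible.tendsto_sideLength_div_side (hk : IsAdmissible c α γ k)
    (hc : ∀ n l, 0 < c n l) (hγ : ∀ n l, 0 < γ n l) (hmono : Monotone γ) (l : Fin d) :
    Tendsto (fun n => (sideLength (c n) (k n) l : ℝ) / (c n l / (k n : ℝ) ^ (1 / (d : ℝ))))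
      atTop (𝓝 1) :=
  tendsto_floor_div_self (hk.tendsto_side hc hγ hmono l)

theorem IsAdmissible.eventually_sideLength_pos (hk : IsAdmissible c α γ k)
    (hc : ∀ n l, 0 < c n l) (hγ : ∀ n l, 0 < γ n l) (hmono : Monotone γ) :
    ∀ᶠ n in atTop, ∀ l, 0 < sideLength (c n) (k n) l := by
  rw [eventually_all]
  intro l
  filter_upwards [(hk.tendsto_side hc hγ hmono l).eventually_ge_atTop 1] with n hn
  exact Int.floor_pos.2 hn

theorem IsAdmissible.tendsto_sideLength_div (hd : 1 ≤ d) (hk : IsAdmissible c α γ k)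
    (hc : ∀ n l, 0 < c n l) (hγ : ∀ n l, 0 < γ n l) (hmono : Monotone γ) (l : Fin d) :
    Tendsto (fun n => (sideLength (c n) (k n) l : ℝ) / c n l) atTop (𝓝 0) := by
  have h := (hk.tendsto_sideLength_div_side hc hγ hmono l).mul
    (hk.tendsto_root hd).inv_tendsto_atTop
  rw [mul_zero] at h
  refine h.congr fun n => ?_
  have h1 := hk.root_pos n
  have h2 := hc n l
  simp only [Pi.inv_apply]
  field_simp

theorem IsAdmissible.tendsto_card_mul_prod_sideLength (hd : 1 ≤ d) (hk : IsAdmissible c α γ k)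
    (hc : ∀ n l, 0 < c n l) (hγ : ∀ n l, 0 < γ n l) (hmono : Monotone γ) :
    Tendsto (fun n => (k n : ℝ) * (∏ l, (sideLength (c n) (k n) l : ℝ)) / ∏ l, c n l)
      atTop (𝓝 1) := by
  have h := tendsto_finsetProd (Finset.univ : Finset (Fin d)) fun l _ =>
    hk.tendsto_sideLength_div_side hc hγ hmono l
  rw [Finset.prod_const_one] at h
  refine h.congr fun n => ?_
  have h1 : ((k n : ℝ) ^ (1 / (d : ℝ))) ^ d = k n := by
    rw [one_div]
    exact Real.rpow_inv_natCast_pow (Nat.cast_nonneg _) (by omega)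
  have h2 : ∀ l, (sideLength (c n) (k n) l : ℝ) / (c n l / (k n : ℝ) ^ (1 / (d : ℝ)))
      = (k n : ℝ) ^ (1 / (d : ℝ)) * (sideLength (c n) (k n) l : ℝ) / c n l := by
    intro l
    rw [div_div_eq_mul_div, mul_comm]
  simp only [h2, Finset.prod_div_distrib, Finset.prod_mul_distrib, Finset.prod_const,
    Finset.card_univ, Fintype.card_fin, h1]

/-- Rounding up costs at most 1, which is negligible because the sides tend to infinity. -/
theorem IsAdmissible.tendsto_ceil_div_sideLength (hk : IsAdmissible c α γ k)
    (hc : ∀ n l, 0 < c n l) (hγ : ∀ n l, 0 < γ n l) (hmono : Monotone γ) (l : Fin d) :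
    Tendsto (fun n => (⌈γ n l⌉ : ℝ) / (sideLength (c n) (k n) l : ℝ)) atTop (𝓝 0) := by
  have hu := hk.tendsto_side hc hγ hmono l
  have h1 : Tendsto (fun n => (⌈γ n l⌉ : ℝ) / (c n l / (k n : ℝ) ^ (1 / (d : ℝ)))) atTop
      (𝓝 0) := by
    have h2 := (hk.sep l).add hu.inv_tendsto_atTop
    rw [add_zero] at h2
    refine squeeze_zero (fun n => ?_) (fun n => ?_) h2
    · have := (Int.ceil_pos.2 (hγ n l)).le
      have := hk.root_pos n
      have := hc n l
      positivity
    · have h3 := hk.root_pos n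
      have h4 := hc n l
      have h5 := (Int.ceil_lt_add_one (γ n l)).le
      calc (⌈γ n l⌉ : ℝ) / (c n l / (k n : ℝ) ^ (1 / (d : ℝ)))
          ≤ (γ n l + 1) / (c n l / (k n : ℝ) ^ (1 / (d : ℝ))) := by gcongr
        _ = _ := by
          simp only [Pi.inv_apply]
          field_simp
  have h2 := h1.div (hk.tendsto_sideLength_div_side hc hγ hmono l) one_ne_zero
  rw [zero_div] at h2
  refine h2.congr' ?_
  filter_upwards [hu.eventually_gt_atTop 0] with n hn
  simp only [Pi.div_apply]
  rw [div_div_div_cancel_right₀ hn.ne']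

/-- With `δ` = |α| + ∑ γ/c → 0, the choice k = ⌊δ^{-1/2}⌋ + 1 tends to infinity while kδ ≤ √δ + δ →
0. This handles both rates, since k^{1/d} ≤ k. -/
theorem exists_isAdmissible (hd : 1 ≤ d) (hc : ∀ n l, 0 < c n l) (hγ : ∀ n l, 0 < γ n l)
    (hα : Tendsto α atTop (𝓝 0)) (hγc : ∀ l, Tendsto (fun n => γ n l / c n l) atTop (𝓝 0)) :
    ∃ k, IsAdmissible c α γ k := by
  set δ : ℕ → ℝ := fun n => |α n| + ∑ l, γ n l / c n l
  have hsum : ∀ n l, γ n l / c n l ≤ ∑ l, γ n l / c n l := fun n l =>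
    Finset.single_le_sum (f := fun l => γ n l / c n l)
      (fun l _ => (div_pos (hγ n l) (hc n l)).le) (Finset.mem_univ l)
  have hδpos : ∀ n, 0 < δ n := fun n => by
    have h1 := hsum n ⟨0, hd⟩
    have h2 := div_pos (hγ n ⟨0, hd⟩) (hc n ⟨0, hd⟩)
    have h3 := abs_nonneg (α n)
    simp only [δ]
    linarith
  have hδ : Tendsto δ atTop (𝓝 0) := by
    have h1 := hα.abs.add (tendsto_finsetSum Finset.univ fun l _ => hγc l)
    simpa using h1
  have hs : Tendsto (fun n => √(δ n)) atTop (𝓝 0) := by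
    have h1 := (Real.continuous_sqrt.tendsto 0).comp hδ
    rwa [Real.sqrt_zero] at h1
  have hspos : ∀ n, 0 < √(δ n) := fun n => Real.sqrt_pos.2 (hδpos n)
  have hinv : Tendsto (fun n => (√(δ n))⁻¹) atTop atTop :=
    tendsto_inv_nhdsGT_zero.comp
      (tendsto_nhdsWithin_iff.2 ⟨hs, Eventually.of_forall hspos⟩)
  have hk : Tendsto (fun n => ((⌊(√(δ n))⁻¹⌋₊ + 1 : ℕ) : ℝ) * δ n) atTop (𝓝 0) := by
    have h1 := hs.add hδ
    rw [add_zero] at h1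
    refine squeeze_zero (fun n => mul_nonneg (Nat.cast_nonneg _) (hδpos n).le) (fun n => ?_) h1
    have h2 := Nat.floor_le (inv_pos.2 (hspos n)).le
    have h3 : (√(δ n))⁻¹ * δ n = √(δ n) := by
      rw [inv_mul_eq_iff_eq_mul₀ (hspos n).ne', Real.mul_self_sqrt (hδpos n).le]
    push_cast
    nlinarith [hδpos n]
  refine ⟨fun n => ⌊(√(δ n))⁻¹⌋₊ + 1, fun n => Nat.succ_pos _, ?_, ?_, fun l => ?_⟩
  · exact tendsto_atTop_mono (fun n => Nat.le_succ _) (tendsto_nat_floor_atTop.comp hinv)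
  · refine squeeze_zero_norm (fun n => ?_) hk
    rw [Real.norm_eq_abs, abs_mul, Nat.abs_cast]
    have : 0 ≤ ∑ l, γ n l / c n l :=
      Finset.sum_nonneg fun l _ => (div_pos (hγ n l) (hc n l)).le
    gcongr
    simp only [δ]
    linarith
  · refine squeeze_zero (fun n => ?_) (fun n => ?_) hk
    · have := hγ n l
      have := hc n l
      positivity
    · rw [mul_div_assoc]
      have h1 : (1 : ℝ) ≤ ((⌊(√(δ n))⁻¹⌋₊ + 1 : ℕ) : ℝ) := by
        exact_mod_cast Nat.succ_pos _
      have h2 : ((⌊(√(δ n))⁻¹⌋₊ + 1 : ℕ) : ℝ) ^ (1 / (d : ℝ))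
          ≤ ((⌊(√(δ n))⁻¹⌋₊ + 1 : ℕ) : ℝ) := by
        refine (Real.rpow_le_rpow_of_exponent_le h1 ?_).trans_eq (Real.rpow_one _)
        exact (div_le_one (by exact_mod_cast hd)).2 (by exact_mod_cast hd)
      have h3 : γ n l / c n l ≤ δ n := (hsum n l).trans (by simp [δ])
      exact mul_le_mul h2 h3 (div_pos (hγ n l) (hc n l)).le (by positivity)

/-! ### The limit theorem -/

variable {Ω : Type*} [MeasurableSpace Ω] {μ : Measure Ω} {ξ : (Fin d → ℤ) → Ω → ℝ}

/-- The conditional probability in the local condition. -/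
noncomputable def localProb (μ : Measure Ω) (ξ : (Fin d → ℤ) → Ω → ℝ)
    (ord : LinearOrder (Fin d → ℤ)) (t : Fin d → ℤ) (x : ℝ) : ℝ :=
  (ProbabilityTheory.cond μ {ω | x < ξ 0 ω}).real
    {ω | fieldMax ξ (laterPoints ord t) ω ≤ (x : EReal)}

theorem measureReal_lastExceedSet_zero [IsProbabilityMeasure μ] (hξ : ∀ v, Measurable (ξ v))
    (ord : LinearOrder (Fin d → ℤ)) (t : Fin d → ℤ) {x : ℝ}
    (hx : 0 < μ.real {ω | x < ξ 0 ω}) :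
    μ.real (lastExceedSet ξ (laterPoints ord t) x 0)
      = μ.real {ω | x < ξ 0 ω} * localProb μ ξ ord t x := by
  have h : lastExceedSet ξ (laterPoints ord t) x 0
      = {ω | x < ξ 0 ω} ∩ {ω | fieldMax ξ (laterPoints ord t) ω ≤ (x : EReal)} := by
    ext ω
    simp only [lastExceedSet, add_zero, fieldMax_le_iff]
    rfl
  rw [h, localProb, Measure.real, Measure.real, Measure.real,
    ProbabilityTheory.cond_apply (measurableSet_lt measurable_const (hξ 0)),
    ENNReal.toReal_mul, ENNReal.toReal_inv]
  exact (mul_inv_cancel_left₀ hx.ne' _).symm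

theorem localProb_nonneg (ord : LinearOrder (Fin d → ℤ)) (t : Fin d → ℤ) (x : ℝ) :
    0 ≤ localProb μ ξ ord t x :=
  measureReal_nonneg

theorem localProb_le_one [IsProbabilityMeasure μ] (ord : LinearOrder (Fin d → ℤ))
    (t : Fin d → ℤ) {x : ℝ} (hx : 0 < μ.real {ω | x < ξ 0 ω}) :
    localProb μ ξ ord t x ≤ 1 := by
  have := ProbabilityTheory.cond_isProbabilityMeasure (μ := μ) (s := {ω | x < ξ 0 ω})
    (fun h => hx.ne' (by simp [Measure.real, h]))
  exact measureReal_le_one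

/-- Both `k N P` and `m N P` tend to `τ`, hence `N P → 0`; together with `b / N → 0` and `k α → 0`
this kills every term of the bound at fixed n. -/
theorem tendsto_probMaxLE_sub_exp [IsProbabilityMeasure μ] (hd : 1 ≤ d)
    (hξ : ∀ v, Measurable (ξ v)) (hstat : IsStationary μ ξ) {ord : LinearOrder (Fin d → ℤ)}
    (hord : ∀ u v w : Fin d → ℤ, ord.lt u v → ord.lt (u + w) (v + w))
    (hD : IndexSetAssumption p D C c) {κ : ℝ} (hκ : IsSurrounding C c κ) {x : ℕ → ℝ} {τ : ℝ}
    (hτ : 0 < τ) (htail : TailTendsto μ ξ D x τ)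
    (hmix : MixingCondition μ ξ c (fun n => latticePoints (scaledBox (c n) κ)) x α γ)
    (hk : IsAdmissible c α γ k) :
    Tendsto (fun n => probMaxLE μ ξ (D n) (x n)
      - Real.exp (-(τ * localProb μ ξ ord (sideLength (c n) (k n)) (x n)))) atTop (𝓝 0) := by
  have hc := hD.scaling_pos
  have hγ := hmix.sep_pos
  have hmono := hmix.sep_mono
  set t : ℕ → Fin d → ℤ := fun n => sideLength (c n) (k n)
  set g : ℕ → Fin d → ℤ := fun n l => ⌈γ n l⌉
  set P : ℕ → ℝ := fun n => μ.real {ω | x n < ξ 0 ω}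
  set N : ℕ → ℝ := fun n => ∏ l, (t n l : ℝ)
  set b : ℕ → ℝ := fun n => ∏ l, (t n l : ℝ) - ∏ l, ((t n l : ℝ) - 2 * g n l)
  set m : ℕ → ℝ := fun n => ((meetingCells (fun l => (t n l : ℝ)) (C n)).ncard : ℝ)
  have htpos : ∀ᶠ n in atTop, ∀ l, 0 < t n l := hk.eventually_sideLength_pos hc hγ hmono
  have htpos' : ∀ᶠ n in atTop, ∀ l, 0 < (t n l : ℝ) := by
    filter_upwards [htpos] with n hn l
    exact_mod_cast hn l
  have hNpos : ∀ᶠ n in atTop, 0 < N n := by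
    filter_upwards [htpos'] with n hn
    exact Finset.prod_pos fun l _ => hn l
  have htc : ∀ l, Tendsto (fun n => (t n l : ℝ) / c n l) atTop (𝓝 0) := fun l =>
    hk.tendsto_sideLength_div hd hc hγ hmono l
  have hgt : ∀ l, Tendsto (fun n => (g n l : ℝ) / (t n l : ℝ)) atTop (𝓝 0) := fun l =>
    hk.tendsto_ceil_div_sideLength hc hγ hmono l
  have htail' : Tendsto (fun n => ((D n).ncard : ℝ) * P n) atTop (𝓝 τ) := htail
  have hcard := hD.tendsto_card
  -- Both |D_n| and f N are asymptotic to ∏ c, so f N may replace |D_n| in the tail condition. It is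
  -- used for `f = k` and `f = m`.
  have hscale : ∀ f : ℕ → ℝ, Tendsto (fun n => f n * N n / ∏ l, c n l) atTop (𝓝 1) →
      Tendsto (fun n => f n * N n * P n) atTop (𝓝 τ) := by
    intro f hf
    have h := (hf.div hcard one_ne_zero).mul htail'
    rw [div_one, one_mul] at h
    refine h.congr' ?_
    filter_upwards [hcard.eventually_const_lt one_pos] with n hn
    have h1 := hD.prod_scaling_pos n
    have h2 : (0 : ℝ) < (D n).ncard := by
      by_contra h0
      have : ((D n).ncard : ℝ) = 0 := le_antisymm (not_lt.1 h0) (Nat.cast_nonneg _)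
      simp [this] at hn
    simp only [Pi.div_apply]
    field_simp
  have hkNP : Tendsto (fun n => (k n : ℝ) * N n * P n) atTop (𝓝 τ) :=
    hscale _ (hk.tendsto_card_mul_prod_sideLength hd hc hγ hmono)
  have hmNP : Tendsto (fun n => m n * N n * P n) atTop (𝓝 τ) :=
    hscale _ (hD.tendsto_card_meetingCells htpos' htc)
  have hkinv : Tendsto (fun n => ((k n : ℝ))⁻¹) atTop (𝓝 0) :=
    (tendsto_natCast_atTop_atTop.comp hk.tendsto_atTop).inv_tendsto_atTop
  have hNP : Tendsto (fun n => N n * P n) atTop (𝓝 0) := by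
    have h := hkNP.mul hkinv
    rw [mul_zero] at h
    refine h.congr fun n => ?_
    have : (0 : ℝ) < k n := by exact_mod_cast hk.one_le n
    field_simp
  have hbN : Tendsto (fun n => b n / N n) atTop (𝓝 0) := by
    have h1 : Tendsto (fun n => 1 - ∏ l, (1 - 2 * ((g n l : ℝ) / (t n l : ℝ)))) atTop (𝓝 0) := by
      have h2 := tendsto_finsetProd (Finset.univ : Finset (Fin d)) fun l _ =>
        (tendsto_const_nhds (x := (1 : ℝ))).sub ((hgt l).const_mul 2)
      simpa using (tendsto_const_nhds (x := (1 : ℝ))).sub h2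
    refine h1.congr' ?_
    filter_upwards [htpos', hNpos] with n hn hN
    rw [sub_div, div_self hN.ne', ← Finset.prod_div_distrib]
    congr 1
    refine Finset.prod_congr rfl fun l _ => ?_
    have := hn l
    field_simp
  have hborder : ∀ f : ℕ → ℝ, Tendsto (fun n => f n * N n * P n) atTop (𝓝 τ) →
      Tendsto (fun n => f n * (b n * P n)) atTop (𝓝 0) := by
    intro f hf
    have h := hf.mul hbN
    rw [mul_zero] at h
    refine h.congr' ?_
    filter_upwards [hNpos] with n hN
    field_simp
  have hsq : ∀ f : ℕ → ℝ, Tendsto (fun n => f n * N n * P n) atTop (𝓝 τ) →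
      Tendsto (fun n => f n * (N n * P n) ^ 2) atTop (𝓝 0) := by
    intro f hf
    have h := hf.mul hNP
    rw [mul_zero] at h
    exact h.congr fun n => by ring
  have hmα : Tendsto (fun n => m n * α n) atTop (𝓝 0) := by
    have h := (hmNP.div hkNP hτ.ne').mul hk.rate
    rw [mul_zero] at h
    refine h.congr' ?_
    filter_upwards [hkNP.eventually_const_lt hτ] with n hn
    have h1 : (k n : ℝ) ≠ 0 := fun h => by simp [h] at hn
    have h2 : N n ≠ 0 := fun h => by simp [h] at hn
    have h3 : P n ≠ 0 := fun h => by simp [h] at hn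
    simp only [Pi.div_apply]
    field_simp
  have hmk : Tendsto (fun n => |m n - k n| * (N n * P n)) atTop (𝓝 0) := by
    have h := (hmNP.sub hkNP).abs
    rw [sub_self, abs_zero] at h
    refine h.congr' ?_
    filter_upwards [hNpos] with n hN
    have h1 : 0 ≤ N n * P n := mul_nonneg hN.le measureReal_nonneg
    have h2 : m n * N n * P n - k n * N n * P n = (m n - k n) * (N n * P n) := by ring
    rw [h2, abs_mul, abs_of_nonneg h1]
  have hcov : Tendsto (fun n => (m n * N n - (D n).ncard) * P n) atTop (𝓝 0) := by
    have h := hmNP.sub htail'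
    rw [sub_self] at h
    exact h.congr fun n => by ring
  have hloc : Tendsto (fun n => (k n : ℝ) * (3 ^ d * (N n * P n) ^ 2 + α n + b n * P n)) atTop
      (𝓝 0) := by
    have h := (((hsq _ hkNP).const_mul (3 ^ d)).add hk.rate).add (hborder _ hkNP)
    simp only [mul_zero, add_zero] at h
    exact h.congr fun n => by ring
  have hlast : Tendsto (fun n => |(k n : ℝ) * (N n * P n) - τ|) atTop (𝓝 0) := by
    have h := (hkNP.sub_const τ).abs
    rw [sub_self, abs_zero] at h
    exact h.congr fun n => by ring_nf
  have hbound := (((((((hcov.add (hborder _ hmNP)).add hmα).add (hborder _ hmNP)).add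
    (hsq _ hmNP)).add hmk).add hloc).add hlast)
  simp only [add_zero] at hbound
  refine squeeze_zero_norm' ?_ hbound
  have hgt' : ∀ᶠ n in atTop, ∀ l, (g n l : ℝ) / (t n l : ℝ) < 1 / 2 := by
    rw [eventually_all]
    exact fun l => (hgt l).eventually_lt_const (by norm_num)
  -- The enlarged block reaches up to `2 * t - 1`, hence the factor 1/2 to keep it inside the
  -- surrounding box.
  have htc' : ∀ᶠ n in atTop, ∀ l, (t n l : ℝ) / c n l < κ / 2 := by
    rw [eventually_all]
    exact fun l => (htc l).eventually_lt_const (half_pos hκ.1)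
  filter_upwards [htpos, htpos', hgt', htc', htail'.eventually_const_lt hτ]
    with n hn hn' hg htκ hDP
  have hP : 0 < P n := by
    refine lt_of_le_of_ne measureReal_nonneg fun h => ?_
    rw [← h] at hDP
    simp at hDP
  have hfin := hD.finite_meetingCells n hn'
  have houter : (⋃ z ∈ hfin.toFinset, latticeBlock (t n) 0 z) = outerApprox (C n) (c n) (k n) := by
    rw [outerApprox_eq]
    simp only [Set.Finite.mem_toFinset]
    rfl
  have key := MixingAt.abs_probMaxLE_sub_exp_le hξ hstat hord (K := latticePoints
    (scaledBox (c n) κ)) (x := x n) (a := α n) (γ := γ n) (hmix.mixing n) (hγ n) (t := t n)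
    (g := g n) (fun l => by
      have h := (div_lt_iff₀ (hn' l)).1 (hg l)
      have h2 : (2 : ℝ) * g n l ≤ t n l := by linarith
      exact_mod_cast h2) (fun l => Int.le_ceil _) (fun v hv l => by
      have h1 : -(t n l : ℝ) ≤ v l := by exact_mod_cast hv.1 l
      have h2 : (v l : ℝ) ≤ 2 * t n l - 1 := by exact_mod_cast hv.2 l
      have h3 := (div_lt_iff₀ (hc n l)).1 (htκ l)
      have h4 := hn' l
      rw [toReal, abs_le]
      constructor <;> linarith) hfin.toFinset (houter ▸ hκ.2 n (k n) (hk.one_le n))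
    (D := D n) (houter ▸ hD.index_eq n ▸ latticePoints_subset_outerApprox hn) (k n)
    (P := P n) (N := N n) (b := b n) rfl rfl rfl hτ.le (localProb_nonneg ord (t n) (x n))
    (localProb_le_one ord (t n) hP) (measureReal_lastExceedSet_zero hξ ord (t n) hP)
  rw [← Set.ncard_eq_toFinset_card _ hfin] at key
  exact key

/-- The exponential is continuous, and so is the logarithm at the positive limit; dividing by `τ >
0` recovers the local probability. -/
theorem tendsto_probMaxLE_iff_localCondition [IsProbabilityMeasure μ] (hd : 1 ≤ d)
    (hξ : ∀ v, Measurable (ξ v)) (hstat : IsStationary μ ξ) {ord : LinearOrder (Fin d → ℤ)}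
    (hord : ∀ u v w : Fin d → ℤ, ord.lt u v → ord.lt (u + w) (v + w))
    (hD : IndexSetAssumption p D C c) {κ : ℝ} (hκ : IsSurrounding C c κ) {x : ℕ → ℝ} {τ : ℝ}
    (hτ : 0 < τ) (htail : TailTendsto μ ξ D x τ)
    (hmix : MixingCondition μ ξ c (fun n => latticePoints (scaledBox (c n) κ)) x α γ)
    (hk : IsAdmissible c α γ k) (θ : ℝ) :
    Tendsto (fun n => probMaxLE μ ξ (D n) (x n)) atTop (𝓝 (Real.exp (-θ * τ)))
      ↔ LocalCondition μ ξ ord c x k θ := by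
  have h := tendsto_probMaxLE_sub_exp hd hξ hstat hord hD hκ hτ htail hmix hk
  have hloc : LocalCondition μ ξ ord c x k θ ↔
      Tendsto (fun n => localProb μ ξ ord (sideLength (c n) (k n)) (x n)) atTop (𝓝 θ) :=
    Iff.rfl
  have hθ : Real.exp (-θ * τ) = Real.exp (-(τ * θ)) := by
    congr 1
    ring
  rw [hloc, hθ]
  constructor
  · intro h1
    have h2 := h1.sub h
    simp only [sub_sub_cancel, sub_zero] at h2
    have h3 := ((Real.continuousAt_log (Real.exp_pos _).ne').tendsto.comp h2).neg.const_mul τ⁻¹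
    simp only [Function.comp_def, Real.log_exp, neg_neg, inv_mul_cancel_left₀ hτ.ne'] at h3
    exact h3
  · intro h1
    have h2 := h.add ((Real.continuous_exp.tendsto _).comp (h1.const_mul τ).neg)
    simp only [Function.comp_def, sub_add_cancel, zero_add] at h2
    exact h2

theorem TailTendsto.tendsto_probMaxLE_of_tailTendsto [IsProbabilityMeasure μ]
    (hξ : ∀ v, Measurable (ξ v)) (hstat : IsStationary μ ξ) (hfin : ∀ n, (D n).Finite)
    {x y : ℕ → ℝ} {τ a : ℝ} (hx : TailTendsto μ ξ D x τ) (hy : TailTendsto μ ξ D y τ)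
    (h : Tendsto (fun n => probMaxLE μ ξ (D n) (x n)) atTop (𝓝 a)) :
    Tendsto (fun n => probMaxLE μ ξ (D n) (y n)) atTop (𝓝 a) := by
  have h1 : Tendsto (fun n => probMaxLE μ ξ (D n) (y n) - probMaxLE μ ξ (D n) (x n)) atTop
      (𝓝 0) := by
    have h2 := (Tendsto.sub hx hy).abs
    rw [sub_self, abs_zero] at h2
    exact squeeze_zero_norm (fun n => probMaxLE_level_sub_le hξ hstat (hfin n) (x n) (y n)) h2
  have h2 := h1.add h
  simpa using h2

end Asymptotics

end SpatialExtremes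

theorem theorem3p8 {d : ℕ} (hd : 1 ≤ d)
    {Ω : Type*} [MeasurableSpace Ω] (μ : Measure Ω) [IsProbabilityMeasure μ]
    (ξ : (Fin d → ℤ) → Ω → ℝ) (hξ : ∀ v, Measurable (ξ v))
    (hstat : SpatialExtremes.IsStationary μ ξ)
    (ord : LinearOrder (Fin d → ℤ))
    (hord : ∀ u v w : Fin d → ℤ, ord.lt u v → ord.lt (u + w) (v + w))
    (p : ℕ) (D : ℕ → Set (Fin d → ℤ)) (C : ℕ → Set (Fin d → ℝ)) (c : ℕ → Fin d → ℝ)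
    (hD : SpatialExtremes.IndexSetAssumption p D C c)
    (κ : ℝ) (hκ : SpatialExtremes.IsSurrounding C c κ)
    (x : ℝ → ℕ → ℝ) (α : ℝ → ℕ → ℝ) (γ : ℝ → ℕ → Fin d → ℝ)
    (htail : ∀ τ : ℝ, 0 < τ → SpatialExtremes.TailTendsto μ ξ D (x τ) τ)
    (hmix : ∀ τ : ℝ, 0 < τ → SpatialExtremes.MixingCondition μ ξ c
      (fun n => SpatialExtremes.latticePoints (SpatialExtremes.scaledBox (c n) κ))
      (x τ) (α τ) (γ τ))
    (θ : ℝ) (hθ : θ ∈ Set.Icc (0 : ℝ) 1) :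
    SpatialExtremes.HasExtremalIndex μ ξ D θ ↔
      ∃ k : ℝ → ℕ → ℕ, ∀ τ : ℝ, 0 < τ →
        SpatialExtremes.IsAdmissible c (α τ) (γ τ) (k τ) ∧
        SpatialExtremes.LocalCondition μ ξ ord c (x τ) (k τ) θ := by
  constructor
  · intro h
    have hex : ∀ τ : ℝ, ∃ k : ℕ → ℕ, 0 < τ → SpatialExtremes.IsAdmissible c (α τ) (γ τ) k := by
      intro τ
      by_cases hτ : 0 < τ
      · have hm := hmix τ hτ
        obtain ⟨k, hk⟩ := SpatialExtremes.exists_isAdmissible hd hD.scaling_pos hm.sep_pos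
          hm.rate_tendsto hm.sep_littleO
        exact ⟨k, fun _ => hk⟩
      -- A dummy value: nothing is required for `τ ≤ 0`.
      · exact ⟨fun _ => 0, fun h => absurd h hτ⟩
    choose k hk using hex
    refine ⟨k, fun τ hτ => ⟨hk τ hτ, ?_⟩⟩
    -- The extremal index supplies its own levels `y`, for which no mixing is known; the limit is
    -- carried over to `x τ`.
    obtain ⟨y, hy, hlim⟩ := h τ hτ
    exact (SpatialExtremes.tendsto_probMaxLE_iff_localCondition hd hξ hstat hord hD hκ hτ
      (htail τ hτ) (hmix τ hτ) (hk τ hτ) θ).1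
      (hy.tendsto_probMaxLE_of_tailTendsto hξ hstat hD.finite (htail τ hτ) hlim)
  · rintro ⟨k, hk⟩ τ hτ
    exact ⟨x τ, htail τ hτ, (SpatialExtremes.tendsto_probMaxLE_iff_localCondition hd hξ hstat
      hord hD hκ hτ (htail τ hτ) (hmix τ hτ) (hk τ hτ).1 θ).2 (hk τ hτ).2⟩
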